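/- All graphs are finite, simple and undirected. A path $(v_1,\dots,v_{2t})$ ($t\ge 1$) in a graph $G$ is repetitively coloured by a vertex colouring $\psi$ if $\psi(v_i)=\psi(v_{t+i})$ for all $i\in\{1,\dots,t\}$. A colouring of $G$ is nonrepetitive if no path of $G$ is repetitively coloured, and the nonrepetitive chromatic number $\pi(G)$ is the minimum integer $k$ such that $G$ has a nonrepetitive colouring with $k$ colours. The Euler genus of a closed surface (orientable or not) with Euler characteristic $\chi$ is $2-\chi$, and the Euler genus of $G$ is the minimum Euler genus of a closed surface in which $G$ embeds, where embeddings are described by a rotation system and an edge signature. That is, it is the minimum of $2c-(|V(G)|-|E(G)|+f)$ over all rotation systems with edge signatures of $G$, where $c$ is the number of connected components of $G$ and $f$ is the number of faces, each isolated vertex contributing one face. Theorem. For every integer $n\ge 1$, every $n$-vertex graph $G$ with Euler genus $g$ satisfies $$\pi(G)\le 8g+12\bigl(1+\log_{3/2} n\bigr).$$ -/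

import Mathlib

namespace SimpleGraph

variable {V : Type*}

/-! ### Nonrepetitive colourings -/

/-- A path `(v₁, …, v₂ₜ)` with `2t ≥ 2` vertices is repetitively coloured by `ψ` if
`ψ(vᵢ) = ψ(vₜ₊ᵢ)` for `i = 1, …, t`. (`Walk.getVert` numbers the vertices from `0`.) -/
def IsRepetitivelyColoured {G : SimpleGraph V} {C : Type*} (ψ : V → C) {u v : V}
    (p : G.Walk u v) : Prop :=
  ∃ t : ℕ, 0 < t ∧ p.length + 1 = 2 * t ∧
    ∀ i < t, ψ (p.getVert i) = ψ (p.getVert (t + i))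

/-- A colouring is nonrepetitive if no path is repetitively coloured. -/
def IsNonrepetitive (G : SimpleGraph V) {C : Type*} (ψ : V → C) : Prop :=
  ∀ (u v : V) (p : G.Walk u v), p.IsPath → ¬ IsRepetitivelyColoured ψ p

/-- The nonrepetitive chromatic number `π(G)`: the least `k` such that `G` has a nonrepetitive
colouring with `k` colours. -/
noncomputable def nonrepetitiveChromaticNumber (G : SimpleGraph V) : ℕ :=
  sInf {k : ℕ | ∃ ψ : V → Fin k, G.IsNonrepetitive ψ}

/-- An injective colouring is nonrepetitive. -/
theorem isNonrepetitive_of_injective (G : SimpleGraph V) {C : Type*} {ψ : V → C}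
    (hψ : Function.Injective ψ) : G.IsNonrepetitive ψ := by
  rintro u v p hp ⟨t, ht, hl, h⟩
  have h0 := hψ (h 0 ht)
  have := hp.getVert_injOn (show 0 ∈ {i | i ≤ p.length} by simp)
    (show t + 0 ∈ {i | i ≤ p.length} by simp only [Set.mem_ofPred_eq]; omega) h0
  omega

/-- The minimum defining `π(G)` is over a nonempty set when `G` is finite. -/
theorem exists_isNonrepetitive [Finite V] (G : SimpleGraph V) :
    {k : ℕ | ∃ ψ : V → Fin k, G.IsNonrepetitive ψ}.Nonempty :=
  ⟨Nat.card V, Finite.equivFin V, G.isNonrepetitive_of_injective (Finite.equivFin V).injective⟩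

/-! ### Embeddings of graphs in closed surfaces

A cellular embedding of a connected graph in a closed surface (orientable or not) is described, up
to homeomorphism, by its rotation system together with its edge signature; conversely every such
pair arises from a cellular embedding. The graph is drawn on small oriented discs around its
vertices, the rotation at `v` is the cyclic order in which the edges leave the disc of `v`, and
the signature of an edge is `1` or `-1` according as the local orientations at its two ends agree
or disagree along the edge. The faces are found by walking along their boundaries. -/

/-- An embedding scheme of `G`: a rotation system and a signature. A dart is an edge directed away
from the vertex `d.fst`; `rot` permutes the darts leaving each vertex cyclically. -/
structure EmbeddingScheme (G : SimpleGraph V) where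
  rot : Equiv.Perm G.Dart
  rot_isCycleOn : ∀ v : V, rot.IsCycleOn {d : G.Dart | d.fst = v}
  sign : G.edgeSet → ℤˣ

namespace EmbeddingScheme

variable {G : SimpleGraph V}

/-- The two sides of a dart near its starting vertex: `(d, 1)` is the side facing the next dart
`rot d` at that vertex, and `(d, -1)` is the side facing the previous dart `rot⁻¹ d`. -/
abbrev DartSide (G : SimpleGraph V) : Type _ := G.Dart × ℤˣ

/-- Move across the corner at the starting vertex: the side `1` of `d` is followed by the side `-1`
of `rot d`, and the side `-1` of `d` is followed by the side `1` of `rot⁻¹ d`. -/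
def acrossCorner (P : EmbeddingScheme G) (x : DartSide G) : DartSide G :=
  ((P.rot ^ (x.2 : ℤ)) x.1, -x.2)

/-- Move along the edge to its other end, staying on the same side of the edge: the name of
the side changes exactly if the local orientations at the two ends agree. -/
def alongEdge (P : EmbeddingScheme G) (x : DartSide G) : DartSide G :=
  (x.1.symm, -(P.sign ⟨x.1.edge, x.1.edge_mem⟩) * x.2)

/-- The facial boundaries that contain an edge: the classes of dart sides under the equivalence
relation generated by the two moves. -/
def FacialWalk (P : EmbeddingScheme G) : Type _ :=
  Quot fun x y : DartSide G => y = P.acrossCorner x ∨ y = P.alongEdge x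

/-- The number of faces, where each component of `G` is embedded in a surface of its own. A
component that is a single vertex lies in a sphere and contributes one face. -/
noncomputable def numFaces (P : EmbeddingScheme G) : ℕ :=
  Nat.card P.FacialWalk + Nat.card {v : V // ∀ w, ¬ G.Adj v w}

/-- The Euler genus of an embedding scheme. If `G` is connected, this is `2 - χ`, where
`χ = |V(G)| - |E(G)| + |F(G)|` is the Euler characteristic of the surface. In general it is the
sum of the Euler genera of the surfaces of the components, that is, the Euler genus of
their connected sum, in which `G` embeds. -/
noncomputable def eulerGenus (P : EmbeddingScheme G) : ℤ :=
  2 * (Nat.card G.ConnectedComponent : ℤ) -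
    ((Nat.card V : ℤ) - (Nat.card G.edgeSet : ℤ) + (P.numFaces : ℤ))

end EmbeddingScheme

/-- `G` embeds in a closed surface of Euler genus at most `g`. -/
def EmbedsInEulerGenus (G : SimpleGraph V) (g : ℕ) : Prop :=
  ∃ P : EmbeddingScheme G, P.eulerGenus ≤ (g : ℤ)

/-- The Euler genus of `G`: the minimum Euler genus of a closed surface in which `G` embeds. -/
noncomputable def eulerGenus (G : SimpleGraph V) : ℕ :=
  sInf {g : ℕ | G.EmbedsInEulerGenus g}

/-- Every finite graph has an embedding scheme. -/
theorem nonempty_embeddingScheme [Finite V] (G : SimpleGraph V) :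
    Nonempty (EmbeddingScheme G) := by
  classical
  have key : ∀ v : V, ∃ f : Equiv.Perm {d : G.Dart // d.fst = v}, f.IsCycleOn Set.univ := by
    intro v
    have : Finite G.Dart := Finite.of_injective _ (Dart.toProd_injective (G := G))
    have := Fintype.ofFinite {d : G.Dart // d.fst = v}
    obtain ⟨f, hf, -⟩ := (Finset.univ : Finset {d : G.Dart // d.fst = v}).exists_cycleOn
    exact ⟨f, by simpa using hf⟩
  choose f hf using key
  let e := Equiv.sigmaFiberEquiv (fun d : G.Dart => d.fst)
  let σ := (Equiv.Perm.sigmaCongrRight f)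
  have hr : ∀ (v : V) (d : {d : G.Dart // d.fst = v}), e.permCongr σ d.1 = (f v d).1 := by
    rintro v ⟨d, rfl⟩
    rfl
  have hrz : ∀ (n : ℕ) (v : V) (d : {d : G.Dart // d.fst = v}),
      ((e.permCongr σ) ^ n) d.1 = (((f v) ^ n) d).1 := by
    intro n
    induction n with
    | zero => intros; rfl
    | succ n ih => intro v d; rw [pow_succ, pow_succ, Equiv.Perm.mul_apply, Equiv.Perm.mul_apply,
        hr, ih]
  have : Finite G.Dart := Finite.of_injective _ (Dart.toProd_injective (G := G))
  refine ⟨⟨e.permCongr σ, fun v => ⟨⟨?_, (Equiv.injective _).injOn, ?_⟩, ?_⟩, fun _ => 1⟩⟩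
  · intro d hd
    have := hr v ⟨d, hd⟩
    simp only at this
    rw [this]
    exact (f v ⟨d, hd⟩).2
  · intro d hd
    refine ⟨((f v).symm ⟨d, hd⟩).1, ((f v).symm ⟨d, hd⟩).2, ?_⟩
    rw [hr]
    simp
  · intro x hx y hy
    obtain ⟨n, hn⟩ := ((hf v).2 (Set.mem_univ ⟨x, hx⟩) (Set.mem_univ ⟨y, hy⟩)).exists_nat_pow_eq
    refine ⟨n, ?_⟩
    have := hrz n v ⟨x, hx⟩
    rw [hn] at this
    simpa using this

/-- The minimum defining the Euler genus is over a nonempty set when `G` is finite. -/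
theorem exists_embedsInEulerGenus [Finite V] (G : SimpleGraph V) :
    {g : ℕ | G.EmbedsInEulerGenus g}.Nonempty := by
  obtain ⟨P⟩ := G.nonempty_embeddingScheme
  exact ⟨P.eulerGenus.toNat, P, Int.self_le_toNat _⟩

end SimpleGraph

/-! ### A square-free word on four letters -/

/-! Colour each vertex by a letter of an infinite word, read at its breadth-first layer, together
with a label. The word has four letters, is square-free, and any three consecutive letters are
distinct. Along a path the layer changes by at most one per step, so the layers form a lazy walk on
the word. If the path is repetitively coloured, corresponding vertices of its halves lie in the same
layer (`lazy_walk_boring`). It therefore suffices that every path has a vertex determined, within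
that path, by its label and layer: its counterpart in the other half would be the same vertex.

A vertical path of the breadth-first forest T meets each layer at most once, so a label naming a
vertical path has this property. For an embedding of Euler genus at most g, search the dual graph
across edges outside T. By Euler's formula at most g edges lie in neither forest
(`card_extraEdges_le`). The vertical paths from their at most 2g ends receive labels of their own.

For the other vertices, the dual forest, with each face replaced by a path of its sides, carries a
decomposition whose bags are unions of three vertical paths. A vertex occupies a connected set of
nodes because one can walk around the contour of its subtree in T (`connOn_nodesOf`). The Helly
property of subtrees yields a bag after whose removal no connected set has more than half of the
vertices (`exists_balanced_bag`). Recursive separation labels these vertices by one of 1 + log₂ n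
depths and one of three paths; a connected set first meets a separator at some depth, and there
label and layer determine the vertex.

In total 4(2g + 3(1 + log₂ n)) colours suffice. Separators that halve give logarithms to base 2,
which is stronger than base 3/2. -/

/-- The Thue–Morse sequence. -/
def thueMorse (n : ℕ) : ℕ :=
  if n = 0 then 0 else if n % 2 = 0 then thueMorse (n / 2) else 1 - thueMorse (n / 2)

theorem thueMorse_le_one (n : ℕ) : thueMorse n ≤ 1 := by
  induction n using Nat.strong_induction_on with
  | _ n ih =>
    rw [thueMorse]
    split_ifs with h0 h1
    · omega
    · exact ih _ (by omega)
    · omega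

theorem thueMorse_two_mul (n : ℕ) : thueMorse (2 * n) = thueMorse n := by
  rcases Nat.eq_zero_or_pos n with rfl | h
  · rfl
  · rw [thueMorse, if_neg (by omega), if_pos (by omega)]
    congr 1
    omega

theorem thueMorse_two_mul_add_one (n : ℕ) : thueMorse (2 * n + 1) = 1 - thueMorse n := by
  rw [thueMorse, if_neg (by omega), if_neg (by omega)]
  congr 2
  omega

theorem thueMorse_ne_succ_of_even {p : ℕ} (hp : p % 2 = 0) :
    thueMorse p ≠ thueMorse (p + 1) := by
  obtain ⟨k, rfl⟩ : ∃ k, p = 2 * k := ⟨p / 2, by omega⟩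
  have := thueMorse_le_one k
  rw [thueMorse_two_mul, thueMorse_two_mul_add_one]
  omega

/-- The Thue–Morse sequence is overlap-free. -/
theorem thueMorse_overlapFree (m : ℕ) (hm : 0 < m) (i : ℕ) :
    ¬ ∀ j ≤ m, thueMorse (i + j) = thueMorse (i + j + m) := by
  induction m using Nat.strong_induction_on generalizing i with
  | _ m ih =>
    intro h
    rcases Nat.even_or_odd' m with ⟨m', rfl | rfl⟩
    -- For an even period, the positions of the parity of `i` form an overlap of half the period.
    · refine ih m' (by omega) (by omega) (i / 2) fun j hj => ?_
      have := h (2 * j) (by omega)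
      have h1 := thueMorse_le_one (i / 2 + j)
      have h2 := thueMorse_le_one (i / 2 + j + m')
      rcases Nat.even_or_odd' i with ⟨i', rfl | rfl⟩
      · rw [show 2 * i' + 2 * j = 2 * (2 * i' / 2 + j) by omega, ← mul_add,
          thueMorse_two_mul, thueMorse_two_mul] at this
        exact this
      · rw [show 2 * i' + 1 + 2 * j = 2 * ((2 * i' + 1) / 2 + j) + 1 by omega,
          show 2 * ((2 * i' + 1) / 2 + j) + 1 + 2 * m' = 2 * ((2 * i' + 1) / 2 + j + m') + 1 by
            omega, thueMorse_two_mul_add_one, thueMorse_two_mul_add_one] at this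
        omega
    -- An odd period shifts odd positions to even ones, where consecutive terms differ. The sequence
    -- thus alternates along a whole period, and the odd length makes the two ends differ.
    · have alt : ∀ p, i ≤ p → p < i + (2 * m' + 1) → thueMorse p ≠ thueMorse (p + 1) := by
        intro p hp hp'
        rcases Nat.mod_two_eq_zero_or_one p with h0 | h0
        · exact thueMorse_ne_succ_of_even h0
        · have h1 := h (p - i) (by omega)
          have h2 := h (p + 1 - i) (by omega)
          have h3 := thueMorse_ne_succ_of_even (p := p + (2 * m' + 1)) (by omega)
          rw [show i + (p - i) = p by omega] at h1
          rw [show i + (p + 1 - i) = p + 1 by omega,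
            show p + 1 + (2 * m' + 1) = p + (2 * m' + 1) + 1 by omega] at h2
          rw [h1, h2]
          exact h3
      have key : ∀ k ≤ 2 * m' + 1,
          (k % 2 = 0 → thueMorse (i + k) = thueMorse i) ∧
          (k % 2 = 1 → thueMorse (i + k) ≠ thueMorse i) := by
        intro k
        induction k with
        | zero => simp
        | succ k ihk =>
          intro hk
          have h1 := ihk (by omega)
          have h2 := alt (i + k) (by omega) (by omega)
          have h3 := thueMorse_le_one (i + k)
          have h4 := thueMorse_le_one (i + k + 1)
          have h5 := thueMorse_le_one i
          rw [← add_assoc]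
          omega
      have h1 := (key (2 * m' + 1) le_rfl).2 (by omega)
      exact h1 (h 0 (by omega)).symm

/-- The sequence of differences of the Thue–Morse sequence, a square-free word on three
letters. -/
def thueWord (n : ℕ) : ℤ := (thueMorse (n + 1) : ℤ) - thueMorse n

/-- In a square both blocks have the same sum of differences. That sum is 0, since twice ±1 is out
of reach for a sequence in {0, 1}; hence the Thue–Morse sequence would have an overlap. -/
theorem thueWord_squareFree (m : ℕ) (hm : 0 < m) (i : ℕ) :
    ¬ ∀ j < m, thueWord (i + j) = thueWord (i + m + j) := by
  intro h
  have key : ∀ j ≤ m, (thueMorse (i + j) : ℤ) - thueMorse i =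
      (thueMorse (i + m + j) : ℤ) - thueMorse (i + m) := by
    intro j
    induction j with
    | zero => simp
    | succ j ihj =>
      intro hj
      have h1 := ihj (by omega)
      have h2 := h j (by omega)
      simp only [thueWord] at h2
      rw [← add_assoc, ← add_assoc]
      omega
  have h0 := key m le_rfl
  have a1 := thueMorse_le_one i
  have a2 := thueMorse_le_one (i + m)
  have a3 := thueMorse_le_one (i + m + m)
  refine thueMorse_overlapFree m hm i fun j hj => ?_
  have h1 := key j hj
  rw [show i + j + m = i + m + j by omega]
  omega

theorem thueWord_bounds (n : ℕ) : -1 ≤ thueWord n ∧ thueWord n ≤ 1 := by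
  have h1 := thueMorse_le_one n
  have h2 := thueMorse_le_one (n + 1)
  unfold thueWord
  omega

theorem thueWord_ne_succ (n : ℕ) : thueWord n ≠ thueWord (n + 1) := by
  intro h
  refine thueWord_squareFree 1 one_pos n fun j hj => ?_
  obtain rfl : j = 0 := by omega
  simpa using h

/-- `thueWord` with a fourth letter inserted between consecutive blocks of length two. -/
def fourWord (n : ℕ) : ℤ := if n % 3 = 2 then 2 else thueWord (2 * (n / 3) + n % 3)

theorem fourWord_bounds (n : ℕ) : -1 ≤ fourWord n ∧ fourWord n ≤ 2 := by
  unfold fourWord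
  have := thueWord_bounds (2 * (n / 3) + n % 3)
  split_ifs <;> omega

theorem fourWord_eq_two_iff (n : ℕ) : fourWord n = 2 ↔ n % 3 = 2 := by
  unfold fourWord
  have := thueWord_bounds (2 * (n / 3) + n % 3)
  split_ifs <;> omega

theorem fourWord_ne_add_one (n : ℕ) : fourWord n ≠ fourWord (n + 1) := by
  intro h
  have h1 := fourWord_eq_two_iff n
  have h2 := fourWord_eq_two_iff (n + 1)
  have h3 : n % 3 = 0 := by omega
  unfold fourWord at h
  rw [if_neg (by omega), if_neg (by omega),
    show 2 * ((n + 1) / 3) + (n + 1) % 3 = 2 * (n / 3) + n % 3 + 1 by omega] at h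
  exact thueWord_ne_succ _ h

theorem fourWord_ne_add_two (n : ℕ) : fourWord n ≠ fourWord (n + 2) := by
  intro h
  have h1 := fourWord_eq_two_iff n
  have h2 := fourWord_eq_two_iff (n + 2)
  have h3 : n % 3 = 1 := by omega
  unfold fourWord at h
  rw [if_neg (by omega), if_neg (by omega),
    show 2 * ((n + 2) / 3) + (n + 2) % 3 = 2 * (n / 3) + n % 3 + 1 by omega] at h
  exact thueWord_ne_succ _ h

theorem fourWord_squareFree (m : ℕ) (hm : 0 < m) (i : ℕ) :
    ¬ ∀ j < m, fourWord (i + j) = fourWord (i + m + j) := by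
  intro h
  have h0 := h 0 hm
  rcases Nat.lt_or_ge m 3 with h3 | h3
  · obtain rfl | rfl : m = 1 ∨ m = 2 := by omega
    · exact fourWord_ne_add_one i h0
    · exact fourWord_ne_add_two i h0
  -- The offset leads to the first position congruent to 2 modulo 3. The letter 2 occurs only at
  -- such positions, so the period preserves them.
  have hd : m % 3 = 0 := by
    have h1 := h ((5 - i % 3) % 3) (by omega)
    have h2 := fourWord_eq_two_iff (i + (5 - i % 3) % 3)
    have h4 := fourWord_eq_two_iff (i + m + (5 - i % 3) % 3)
    omega
  obtain ⟨k, rfl⟩ : ∃ k, m = 3 * k := ⟨m / 3, by omega⟩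
  -- Deleting the inserted letters leaves a square of `thueWord`. If `i % 3 = 2`, the starting index
  -- is that of the next block, as it should be.
  refine thueWord_squareFree (2 * k) (by omega) (2 * (i / 3) + i % 3) fun j hj => ?_
  set q := 2 * (i / 3) + i % 3 + j with hq
  have h1 := h (3 * (q / 2) + q % 2 - i) (by omega)
  unfold fourWord at h1
  rw [if_neg (by omega), if_neg (by omega)] at h1
  convert h1 using 2 <;> omega

/-- There is an infinite square-free word on four letters in which any three consecutive letters are
distinct. -/
theorem exists_squareFree_word : ∃ w : ℕ → Fin 4,
    (∀ x y : ℕ, x ≤ y + 2 → y ≤ x + 2 → w x = w y → x = y) ∧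
    ∀ i m : ℕ, 0 < m → ¬ ∀ j < m, w (i + j) = w (i + m + j) := by
  have hinj : ∀ x y, (⟨(fourWord x + 1).toNat, by have := fourWord_bounds x; omega⟩ : Fin 4) =
      ⟨(fourWord y + 1).toNat, by have := fourWord_bounds y; omega⟩ → fourWord x = fourWord y := by
    intro x y h
    have h1 := fourWord_bounds x
    have h2 := fourWord_bounds y
    rw [Fin.mk.injEq] at h
    omega
  refine ⟨fun n => ⟨(fourWord n + 1).toNat, by have := fourWord_bounds n; omega⟩, ?_, ?_⟩
  · intro x y hxy hyx h
    have h' := hinj _ _ h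
    by_contra hne
    obtain rfl | rfl | rfl | rfl : x = y + 1 ∨ x = y + 2 ∨ y = x + 1 ∨ y = x + 2 := by omega
    · exact fourWord_ne_add_one _ h'.symm
    · exact fourWord_ne_add_two _ h'.symm
    · exact fourWord_ne_add_one _ h'
    · exact fourWord_ne_add_two _ h'
  · intro i m hm h
    exact fourWord_squareFree m hm i fun j hj => hinj _ _ (h j hj)

/-! ### Repetitively coloured lazy walks -/

/-- A discrete intermediate value theorem. -/
theorem exists_eq_of_lazy {l : ℕ → ℕ} {n : ℕ}
    (hl : ∀ i < n, l (i + 1) ≤ l i + 1 ∧ l i ≤ l (i + 1) + 1) {x : ℕ}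
    (hx : l 0 ≤ x ∧ x ≤ l n ∨ l n ≤ x ∧ x ≤ l 0) : ∃ i ≤ n, l i = x := by
  induction n with
  | zero => exact ⟨0, le_rfl, by omega⟩
  | succ n ih =>
    by_cases h : l (n + 1) = x
    · exact ⟨n + 1, le_rfl, h⟩
    · have := hl n (by omega)
      obtain ⟨i, hi, hi'⟩ := ih (fun i hi => hl i (by omega)) (by omega)
      exact ⟨i, by omega, hi'⟩

/-- In a repetitively coloured lazy walk the second half follows the first half by a translation or
by a reflection. -/
theorem lazy_translation_or_reflection {C : Type*} {w : ℕ → C}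
    (hw : ∀ x y : ℕ, x ≤ y + 2 → y ≤ x + 2 → w x = w y → x = y) {l : ℕ → ℕ} {t : ℕ}
    (hl : ∀ i, i + 1 < 2 * t → l (i + 1) ≤ l i + 1 ∧ l i ≤ l (i + 1) + 1)
    (hc : ∀ i < t, w (l i) = w (l (t + i))) :
    (∀ i < t, (l (t + i) : ℤ) - l t = l i - l 0) ∨
    (∀ i < t, (l (t + i) : ℤ) - l t = - (l i - l 0)) := by
  -- The first move of each half fixes the sign `ρ`. The witness `j` is an earlier index at a
  -- position next to the current one, so that the next position is within distance two of it.
  have key : ∀ k < t, (∀ i ≤ k, l i = l 0 ∧ l (t + i) = l t) ∨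
      ∃ ρ : ℤ, (ρ = 1 ∨ ρ = -1) ∧ (∀ i ≤ k, (l (t + i) : ℤ) - l t = ρ * (l i - l 0)) ∧
        ∃ j < k, l j ≠ l k ∧ l j ≤ l k + 1 ∧ l k ≤ l j + 1 := by
    intro k
    induction k with
    | zero =>
      intro _
      left
      intro i hi
      obtain rfl : i = 0 := by omega
      simp
    | succ k ih =>
      intro hk
      have l1 := hl k (by omega)
      have l2 := hl (t + k) (by omega)
      have c1 := hc k (by omega)
      have c2 := hc (k + 1) hk
      rw [← add_assoc] at c2
      have e1 : l (k + 1) = l k ↔ l (t + k + 1) = l (t + k) := by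
        constructor <;> intro h <;> apply hw _ _ (by omega) (by omega)
        · rw [← c2, h, c1]
        · rw [c2, h, ← c1]
      rcases ih (by omega) with h | ⟨ρ, hρ, h, j, hj, hjne, hj1, hj2⟩
      · have hkk := h k le_rfl
        by_cases h0 : l (k + 1) = l k
        · left
          intro i hi
          rcases Nat.lt_or_ge i (k + 1) with hi' | hi'
          · exact h i (by omega)
          · obtain rfl : i = k + 1 := by omega
            rw [← add_assoc]
            omega
        · right
          refine ⟨((l (t + k + 1) : ℤ) - l t) * (l (k + 1) - l 0), ?_, ?_,
            k, by omega, by omega, by omega, by omega⟩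
          · have a1 : (l (k + 1) : ℤ) - l 0 = 1 ∨ (l (k + 1) : ℤ) - l 0 = -1 := by omega
            have a2 : (l (t + k + 1) : ℤ) - l t = 1 ∨ (l (t + k + 1) : ℤ) - l t = -1 := by omega
            rcases a1 with a1 | a1 <;> rcases a2 with a2 | a2 <;> simp [a1, a2]
          · intro i hi
            rcases Nat.lt_or_ge i (k + 1) with hi' | hi'
            · have := h i (by omega)
              simp [this]
            · obtain rfl : i = k + 1 := by omega
              rw [← add_assoc]
              have a1 : (l (k + 1) : ℤ) - l 0 = 1 ∨ (l (k + 1) : ℤ) - l 0 = -1 := by omega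
              rcases a1 with a1 | a1 <;> simp [a1]
      · right
        have cj := hc j (by omega)
        have hkk := h k le_rfl
        have hjj := h j (by omega)
        -- Letters at distance at most two identify positions, so the halves turn back at the same
        -- moments.
        have e2 : l (k + 1) = l j ↔ l (t + k + 1) = l (t + j) := by
          constructor <;> intro h <;> apply hw _ _ _ _ _
          any_goals rcases hρ with rfl | rfl <;> omega
          · rw [← c2, h, cj]
          · rw [c2, h, ← cj]
        have hstep : (l (t + k + 1) : ℤ) - l t = ρ * (l (k + 1) - l 0) := by
          rcases hρ with rfl | rfl <;> omega
        refine ⟨ρ, hρ, ?_, ?_⟩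
        · intro i hi
          rcases Nat.lt_or_ge i (k + 1) with hi' | hi'
          · exact h i (by omega)
          · obtain rfl : i = k + 1 := by omega
            rw [← add_assoc]
            exact hstep
        · by_cases h0 : l (k + 1) = l k
          · exact ⟨j, by omega, by omega, by omega, by omega⟩
          · exact ⟨k, by omega, by omega, by omega, by omega⟩
  rcases Nat.eq_zero_or_pos t with rfl | ht
  · left
    intro i hi
    omega
  rcases key (t - 1) (by omega) with h | ⟨ρ, rfl | rfl, h, -⟩
  · left
    intro i hi
    have := h i (by omega)
    omega
  · left
    intro i hi
    have := h i (by omega)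
    omega
  · right
    intro i hi
    have := h i (by omega)
    omega

/-- A repetitively coloured lazy walk visits the same positions in its two halves. -/
theorem lazy_walk_boring {C : Type*} {w : ℕ → C}
    (hw : ∀ x y : ℕ, x ≤ y + 2 → y ≤ x + 2 → w x = w y → x = y)
    (hsq : ∀ i m : ℕ, 0 < m → ¬ ∀ j < m, w (i + j) = w (i + m + j)) {l : ℕ → ℕ} {t : ℕ}
    (hl : ∀ i, i + 1 < 2 * t → l (i + 1) ≤ l i + 1 ∧ l i ≤ l (i + 1) + 1)
    (hc : ∀ i < t, w (l i) = w (l (t + i))) : ∀ i < t, l i = l (t + i) := by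
  rcases Nat.eq_zero_or_pos t with rfl | ht
  · intro i hi
    omega
  have hlast := hl (t - 1) (by omega)
  rw [show t - 1 + 1 = t by omega] at hlast
  have hlazy : ∀ i < t - 1, l (i + 1) ≤ l i + 1 ∧ l i ≤ l (i + 1) + 1 :=
    fun i hi => hl i (by omega)
  rcases lazy_translation_or_reflection hw hl hc with h | h
  · rcases lt_trichotomy (l 0) (l t) with h0 | h0 | h0
    · exfalso
      -- The first half covers every position from `l 0` to `l t - 1`, and its translate continues
      -- the word with the same letters.
      refine hsq (l 0) (l t - l 0) (by omega) fun j hj => ?_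
      obtain ⟨i, hi, hi'⟩ := exists_eq_of_lazy hlazy (x := l 0 + j) (by omega)
      have h1 := h i (by omega)
      rw [← hi', hc i (by omega)]
      congr 1
      omega
    · intro i hi
      have := h i hi
      omega
    · exfalso
      -- The first half covers `l t + 1` to `l 0`. The translate of this interval lies just below
      -- it; its lower end is named `l (t + i)`, which avoids truncated subtraction.
      obtain ⟨i, hi, hi'⟩ := exists_eq_of_lazy hlazy (x := l t + 1) (by omega)
      have h1 := h i (by omega)
      refine hsq (l (t + i)) (l 0 - l t) (by omega) fun j hj => ?_
      obtain ⟨i', hi1, hi2⟩ := exists_eq_of_lazy hlazy (x := l t + 1 + j) (by omega)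
      have h2 := h i' (by omega)
      have h3 := hc i' (by omega)
      rw [show l (t + i) + (l 0 - l t) + j = l i' by omega, h3]
      congr 1
      omega
  -- Under a reflection the difference of the two positions changes by 0 or ±2 per step, and ±1, ±2
  -- are excluded. Its sign is therefore constant, and a nonzero one is incompatible with `l (t -
  -- 1)` and `l t` being at most one apart.
  · have hgap : ∀ i < t, l i = l (t + i) ∨ l (t + i) + 3 ≤ l i ∨ l i + 3 ≤ l (t + i) := by
      intro i hi
      by_contra hcon
      have := hw (l i) (l (t + i)) (by omega) (by omega) (hc i hi)
      omega
    have hconst : ∀ i < t, (l 0 = l t → l i = l (t + i)) ∧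
        (l t < l 0 → l (t + i) < l i) ∧ (l 0 < l t → l i < l (t + i)) := by
      intro i
      induction i with
      | zero => simp
      | succ i ih =>
        intro hi
        have h1 := ih (by omega)
        have h2 := hgap i (by omega)
        have h3 := hgap (i + 1) hi
        have h4 := hl i (by omega)
        have h5 := h i (by omega)
        have h6 := h (i + 1) hi
        omega
    have hend := hconst (t - 1) (by omega)
    have hend' := h (t - 1) (by omega)
    have hgap0 := hgap 0 ht
    rw [add_zero] at hgap0
    intro i hi
    exact (hconst i hi).1 (by omega)

/-! ### Connected sets, rooted forests and subtrees -/

open Relation in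
/-- The set `S` is connected with respect to the relation `r`. -/
def ConnOn {N : Type*} (r : N → N → Prop) (S : Set N) : Prop :=
  ∀ x ∈ S, ∀ y ∈ S, ReflTransGen (fun a b => r a b ∧ b ∈ S) x y

/-- The adjacency relation of the rooted forest with parent function `par`. -/
def ForestAdj {N : Type*} (par : N → Option N) (x y : N) : Prop :=
  par x = some y ∨ par y = some x

theorem ConnOn.exists_rel_of_two_le {N : Type*} {r : N → N → Prop} {C : Finset N}
    (hC : ConnOn r (C : Set N)) (h2 : 2 ≤ C.card) {v : N} (hv : v ∈ C) : ∃ u ∈ C, r v u := by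
  obtain ⟨u, hu, hne⟩ := Finset.exists_mem_ne (by omega : 1 < C.card) v
  rcases (hC v hv u hu).cases_head with h | ⟨c, ⟨hc, hcC⟩, -⟩
  · exact absurd h.symm hne
  · exact ⟨c, hcC, hc⟩

/-- Turns a connected set of vertices into a connected set of nodes, to which the Helly property
applies. -/
theorem ConnOn.biUnion {V N : Type*} {r : V → V → Prop} {q : N → N → Prop} {C : Set V}
    (hC : ConnOn r C) {S : V → Set N} (hS : ∀ v ∈ C, ConnOn q (S v))
    (hr : ∀ u ∈ C, ∀ v ∈ C, r u v → (S u ∩ S v).Nonempty) : ConnOn q (⋃ v ∈ C, S v) := by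
  intro x hx y hy
  simp only [Set.mem_iUnion, exists_prop] at hx hy
  obtain ⟨u, hu, hxu⟩ := hx
  obtain ⟨v, hv, hyv⟩ := hy
  have mono : ∀ c ∈ C, ∀ a b, Relation.ReflTransGen (fun a b => q a b ∧ b ∈ S c) a b →
      Relation.ReflTransGen (fun a b => q a b ∧ b ∈ ⋃ v ∈ C, S v) a b := by
    intro c hc a b hab
    exact Relation.ReflTransGen.mono (fun a b h => ⟨h.1, Set.mem_biUnion hc h.2⟩) _ _ hab
  have key : ∀ v, Relation.ReflTransGen (fun a b => r a b ∧ b ∈ C) u v → v ∈ C ∧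
      ∀ y ∈ S v, Relation.ReflTransGen (fun a b => q a b ∧ b ∈ ⋃ v ∈ C, S v) x y := by
    intro v huv
    induction huv with
    | refl => exact ⟨hu, fun y hy => mono u hu _ _ (hS u hu x hxu y hy)⟩
    | tail _ hbc ih =>
      refine ⟨hbc.2, fun y hy => ?_⟩
      obtain ⟨z, hz1, hz2⟩ := hr _ ih.1 _ hbc.2 hbc.1
      exact (ih.2 z hz1).trans (mono _ hbc.2 _ _ (hS _ hbc.2 z hz2 y hy))
  exact (key v (hC u hu v hv)).2 y hyv

section Forest

variable {N α : Type*} [Finite N] [LinearOrder α] {rank : N → α} {par : N → Option N}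

/-- A nonempty connected set of nodes of a rooted forest is a subtree with a topmost node. -/
theorem ConnOn.exists_top (hpar : ∀ x p, par x = some p → rank p < rank x) {S : Set N}
    (hS : ConnOn (ForestAdj par) S) (hne : S.Nonempty) :
    ∃ t ∈ S, (∀ x ∈ S, rank t ≤ rank x) ∧ ∀ x ∈ S, x ≠ t → ∃ p ∈ S, par x = some p := by
  obtain ⟨t, ht, hmin⟩ := Set.exists_min_image S rank S.toFinite hne
  refine ⟨t, ht, hmin, ?_⟩
  have key : ∀ x, Relation.ReflTransGen (fun a b => ForestAdj par a b ∧ b ∈ S) t x → x ∈ S ∧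
      Relation.ReflTransGen (fun x p => par x = some p ∧ p ∈ S) x t := by
    intro x hx
    induction hx with
    | refl => exact ⟨ht, .refl⟩
    | @tail b c _ hbc ih =>
      refine ⟨hbc.2, ?_⟩
      rcases hbc.1 with h | h
      · rcases ih.2.cases_head with rfl | ⟨c', ⟨hc', -⟩, hct⟩
        · exact absurd (hmin c hbc.2) (not_le.2 (hpar _ _ h))
        · rw [h, Option.some_inj] at hc'
          rwa [hc']
      · exact .head ⟨h, ih.1⟩ ih.2
  intro x hx hxt
  rcases (key x (hS t ht x hx)).2.cases_head with h | ⟨c, ⟨hc, hcS⟩, -⟩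
  · exact absurd h hxt
  · exact ⟨c, hcS, hc⟩

/-- The Helly property of subtrees of a rooted forest. -/
theorem ConnOn.exists_common (hpar : ∀ x p, par x = some p → rank p < rank x) {ι : Type*}
    [Finite ι] [Nonempty ι] {A : ι → Set N} (hA : ∀ i, ConnOn (ForestAdj par) (A i))
    (hint : ∀ i j, (A i ∩ A j).Nonempty) : ∃ x, ∀ i, x ∈ A i := by
  choose t htA hmin htop using fun i => (hA i).exists_top hpar (hint i i).left
  -- The lowest of the topmost nodes is common to all: from a point of `A i ∩ A j`, climbing to `t
  -- i` cannot leave `A j`, whose top is no lower.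
  obtain ⟨i, hi⟩ := Finite.exists_max fun i => rank (t i)
  refine ⟨t i, fun j => ?_⟩
  have wf : WellFounded fun x y : N => rank x < rank y :=
    have : IsTrans N fun x y => rank x < rank y := ⟨fun _ _ _ => lt_trans⟩
    have : Std.Irrefl fun x y : N => rank x < rank y := ⟨fun _ => lt_irrefl _⟩
    Finite.wellFounded_of_trans_of_irrefl _
  obtain ⟨x, hxi, hxj⟩ := hint i j
  induction x using wf.induction with
  | _ x ih =>
    by_cases hx : x = t i
    · rwa [← hx]
    · obtain ⟨p, hp, hpx⟩ := htop i x hxi hx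
      have hlt := hpar x p hpx
      have hxt : x ≠ t j := by
        rintro rfl
        exact absurd ((hmin i p hp).trans_lt hlt) (not_lt.2 (hi j))
      obtain ⟨p', hp', hpx'⟩ := htop j x hxj hxt
      rw [hpx, Option.some_inj] at hpx'
      exact ih p hlt hp (hpx' ▸ hp')

/-- Every tree-decomposition of a graph has a bag that splits a given set of vertices in a balanced
way. Here `S v` is the set of nodes whose bag contains `v`. -/
theorem exists_balanced_bag [Nonempty N] (hpar : ∀ x p, par x = some p → rank p < rank x)
    {V : Type*} {r : V → V → Prop} {S : V → Set N} {B : Finset V}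
    (hS : ∀ v ∈ B, ConnOn (ForestAdj par) (S v))
    (hr : ∀ u ∈ B, ∀ v ∈ B, r u v → (S u ∩ S v).Nonempty) :
    ∃ x, ∀ C ⊆ B, ConnOn r (C : Set V) → 2 ≤ C.card → (∀ v ∈ C, x ∉ S v) →
      2 * C.card ≤ B.card := by
  classical
  -- Otherwise every node has a connected set of more than half of `B` that avoids its bag. Two such
  -- sets meet, so the subtrees they span have a common node, whose own set then contradicts its
  -- choice. Having two vertices gives each member a neighbour, hence a nonempty set of nodes.
  by_contra! hcon
  choose C hCB hC hC2 hCx hCcard using hcon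
  obtain ⟨x, hx⟩ := ConnOn.exists_common hpar (A := fun x => ⋃ v ∈ C x, S v)
    (fun x => (hC x).biUnion (fun v hv => hS v (hCB x hv))
      fun u hu v hv => hr u (hCB x hu) v (hCB x hv)) (by
      intro x y
      have hne : (C x ∩ C y).Nonempty := by
        rw [← Finset.card_pos]
        have h1 := Finset.card_union_add_card_inter (C x) (C y)
        have h2 := Finset.card_le_card (Finset.union_subset (hCB x) (hCB y))
        have := hCcard x
        have := hCcard y
        omega
      obtain ⟨v, hv⟩ := hne
      rw [Finset.mem_inter] at hv
      obtain ⟨u, hu, hvu⟩ := (hC x).exists_rel_of_two_le (hC2 x) hv.1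
      obtain ⟨z, hz, -⟩ := hr v (hCB x hv.1) u (hCB x hu) hvu
      exact ⟨z, Set.mem_biUnion hv.1 hz, Set.mem_biUnion hv.2 hz⟩)
  have := hx x
  simp only [Set.mem_iUnion, exists_prop] at this
  obtain ⟨v, hv, hxv⟩ := this
  exact hCx x v hv hxv

end Forest

/-! ### Breadth-first search -/

/-- `IsAncestor layer par w u`: the vertex `w` is an ancestor of `u`, or `u` itself, in the rooted
forest in which each vertex `c` with `0 < layer c` has parent `par c`. -/
def IsAncestor {V : Type*} (layer : V → ℕ) (par : V → V) (w u : V) : Prop :=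
  Relation.ReflTransGen (fun c p => 0 < layer c ∧ par c = p) u w

section Ancestor

variable {V : Type*} {layer : V → ℕ} {par : V → V}

theorem IsAncestor.refl (u : V) : IsAncestor layer par u u := Relation.ReflTransGen.refl

theorem IsAncestor.trans {u v w : V} (h₁ : IsAncestor layer par u v)
    (h₂ : IsAncestor layer par v w) : IsAncestor layer par u w :=
  Relation.ReflTransGen.trans h₂ h₁

theorem IsAncestor.parent {c : V} (hc : 0 < layer c) : IsAncestor layer par (par c) c :=
  Relation.ReflTransGen.single ⟨hc, rfl⟩

theorem IsAncestor.layer_le (hlayer : ∀ u, 0 < layer u → layer u = layer (par u) + 1) {w u : V}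
    (h : IsAncestor layer par w u) : w = u ∨ layer w < layer u := by
  induction h with
  | refl => exact .inl rfl
  | @tail b c _ hbc ih =>
    have := hlayer b hbc.1
    rw [hbc.2] at this
    rcases ih with rfl | ih <;> right <;> omega

/-- Ancestors of one vertex form a chain along which the layer strictly decreases. This is why a
vertical path and a layer determine a vertex. -/
theorem IsAncestor.eq_of_layer_eq (hlayer : ∀ u, 0 < layer u → layer u = layer (par u) + 1)
    {w w' u : V} (h : IsAncestor layer par w u) (h' : IsAncestor layer par w' u)
    (heq : layer w = layer w') : w = w' := by
  rcases Relation.ReflTransGen.total_of_right_unique (fun a b c hb hc => hb.2.symm.trans hc.2)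
    h h' with h | h
  · rcases IsAncestor.layer_le hlayer h with h | h
    · exact h.symm
    · omega
  · rcases IsAncestor.layer_le hlayer h with h | h
    · exact h
    · omega

end Ancestor

theorem SimpleGraph.Reachable.exists_adj_dist_eq_add_one {V : Type*} {G : SimpleGraph V} {r u : V}
    (h : G.Reachable r u) (hpos : 0 < G.dist r u) :
    ∃ p, G.Adj u p ∧ G.dist r u = G.dist r p + 1 := by
  obtain ⟨p, hp⟩ := h.symm.exists_walk_length_eq_dist
  rw [dist_comm] at hp
  cases p with
  | nil => simp at hpos
  | @cons _ v _ huv q =>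
    refine ⟨v, huv, ?_⟩
    rw [Walk.length_cons] at hp
    have h1 := dist_le q
    rw [dist_comm] at h1
    obtain ⟨q', hq'⟩ := (h.trans huv.reachable).exists_walk_length_eq_dist
    have h3 := dist_le (q'.concat huv.symm)
    rw [Walk.length_concat] at h3
    omega

/-- Breadth-first search in every component of a graph. -/
theorem SimpleGraph.exists_bfs {V : Type*} (G : SimpleGraph V) :
    ∃ (layer : V → ℕ) (par : V → V),
      (∀ u, 0 < layer u → G.Adj u (par u) ∧ layer u = layer (par u) + 1) ∧
      (∀ u v, G.Adj u v → layer u ≤ layer v + 1) ∧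
      Nat.card {u // layer u = 0} = Nat.card G.ConnectedComponent := by
  let root : V → V := fun u => (G.connectedComponentMk u).out
  have hroot : ∀ u, G.Reachable (root u) u := fun u =>
    ConnectedComponent.exact (Quot.out_eq (G.connectedComponentMk u))
  have hadj : ∀ u v, G.Adj u v → root u = root v := fun u v h => by
    simp only [root, ConnectedComponent.connectedComponentMk_eq_of_adj h]
  have hpar : ∀ u, ∃ p, 0 < G.dist (root u) u →
      G.Adj u p ∧ G.dist (root u) u = G.dist (root p) p + 1 := by
    intro u
    rcases Nat.eq_zero_or_pos (G.dist (root u) u) with h | h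
    · exact ⟨u, fun h' => by omega⟩
    · obtain ⟨p, hp, hd⟩ := (hroot u).exists_adj_dist_eq_add_one h
      exact ⟨p, fun _ => ⟨hp, by rw [hd, hadj u p hp]⟩⟩
  choose par hpar using hpar
  refine ⟨fun u => G.dist (root u) u, par, hpar, ?_, ?_⟩
  · intro u v h
    obtain ⟨q, hq⟩ := (hroot v).exists_walk_length_eq_dist
    have h3 := dist_le (q.concat h.symm)
    rw [Walk.length_concat, hq, ← hadj u v h] at h3
    simpa only [hadj u v h] using h3
  · refine Nat.card_congr (Equiv.ofBijective (fun u => G.connectedComponentMk u.1) ⟨?_, ?_⟩)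
    · rintro ⟨u, hu⟩ ⟨v, hv⟩ h
      have h1 := (hroot u).dist_eq_zero_iff.1 hu
      have h2 := (hroot v).dist_eq_zero_iff.1 hv
      simp only [root] at h1 h2
      rw [Subtype.mk.injEq, ← h1, ← h2]
      exact congrArg _ h
    · intro c
      refine ⟨⟨c.out, ?_⟩, Quot.out_eq c⟩
      have : root c.out = c.out := by
        simp only [root]
        exact congrArg _ (Quot.out_eq c)
      change G.dist (root c.out) c.out = 0
      rw [this, dist_self]

/-! ### Flags of an embedding scheme -/

/-- The edges of the rooted forest with parent function `par`. -/
def treeEdges {V : Type*} (layer : V → ℕ) (par : V → V) : Set (Sym2 V) :=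
  {e | ∃ u, 0 < layer u ∧ e = s(u, par u)}

theorem card_pos_add_card_eq_zero {A : Type*} [Finite A] (l : A → ℕ) :
    Nat.card {a // 0 < l a} + Nat.card {a // l a = 0} = Nat.card A := by
  rw [← Nat.card_sum]
  refine Nat.card_congr (((Equiv.refl _).sumCongr (Equiv.subtypeEquivRight fun a => ?_)).trans
    (Equiv.sumCompl fun a => 0 < l a))
  omega

namespace SimpleGraph.EmbeddingScheme

variable {V : Type*} {G : SimpleGraph V}

/-- Move across an edge, staying at the same end. -/
def flip (x : DartSide G) : DartSide G := (x.1, -x.2)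

theorem flip_flip (x : DartSide G) : flip (flip x) = x := by simp [flip]

variable (P : EmbeddingScheme G)

theorem acrossCorner_involutive : Function.Involutive P.acrossCorner := by
  rintro ⟨d, s⟩
  rcases Int.units_eq_one_or s with rfl | rfl <;> simp [acrossCorner]

theorem alongEdge_involutive : Function.Involutive P.alongEdge := by
  rintro ⟨d, s⟩
  simp [alongEdge, ← mul_assoc]

theorem alongEdge_flip (x : DartSide G) : P.alongEdge (flip x) = flip (P.alongEdge x) := by
  simp [alongEdge, flip]

theorem acrossCorner_ne (x : DartSide G) : P.acrossCorner x ≠ x := by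
  intro h
  have := congrArg Prod.snd h
  rcases Int.units_eq_one_or x.2 with h | h <;> simp [acrossCorner, h] at this

theorem alongEdge_ne (x : DartSide G) : P.alongEdge x ≠ x := fun h =>
  x.1.symm_ne (congrArg Prod.fst h)

theorem acrossCorner_fst (x : DartSide G) : (P.acrossCorner x).1.fst = x.1.fst := by
  have hmap : ∀ d, (P.rot d).fst = d.fst := fun d =>
    (P.rot_isCycleOn d.fst).1.mapsTo (show d ∈ {d' : G.Dart | d'.fst = d.fst} from rfl)
  obtain ⟨d, s⟩ := x
  rcases Int.units_eq_one_or s with rfl | rfl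
  · simpa [acrossCorner] using hmap d
  · have := hmap (P.rot⁻¹ d)
    rw [← Equiv.Perm.mul_apply, mul_inv_cancel, Equiv.Perm.one_apply] at this
    simpa [acrossCorner] using this.symm

theorem alongEdge_edge (x : DartSide G) : (P.alongEdge x).1.edge = x.1.edge := x.1.edge_symm

theorem eq_of_edge_eq {x y : DartSide G} (h : y.1.edge = x.1.edge) :
    y = x ∨ y = flip x ∨ y = P.alongEdge x ∨ y = flip (P.alongEdge x) := by
  have hs : ∀ s t : ℤˣ, s = t ∨ s = -t := by decide
  rcases (dart_edge_eq_iff _ _).1 h with h | h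
  · rcases hs y.2 x.2 with h' | h'
    · exact .inl (Prod.ext h h')
    · exact .inr (.inl (Prod.ext h h'))
  · rcases hs y.2 (P.alongEdge x).2 with h' | h'
    · exact .inr (.inr (.inl (Prod.ext h h')))
    · exact .inr (.inr (.inr (Prod.ext h h')))

/-! ### Walking around a vertex and around a subtree -/

section Contour

variable [Finite V]

theorem finite_dart : Finite G.Dart :=
  Finite.of_injective _ (Dart.toProd_injective (G := G))

/-- Walking around a vertex. All its sides are related, even if one dart may not be crossed. -/
theorem related_of_same_vertex {w : V} {R : DartSide G → DartSide G → Prop} (hR : Equivalence R)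
    {bad : G.Dart → Prop} (hbad : ∀ d d', bad d → bad d' → d = d')
    (hbadw : ∀ d, bad d → d.fst = w)
    (ha : ∀ y, y.1.fst = w → R y (P.acrossCorner y))
    (hf : ∀ y, y.1.fst = w → ¬ bad y.1 → R y (flip y)) {y y' : DartSide G}
    (hy : y.1.fst = w) (hy' : y'.1.fst = w) : R y y' := by
  have := finite_dart (G := G)
  -- The rotation is a cycle, so starting at the forbidden dart one reaches all the others without
  -- crossing it.
  obtain ⟨d₀, hd₀, hb⟩ : ∃ d₀ : G.Dart, d₀.fst = w ∧ ∀ d, bad d → d = d₀ := by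
    by_cases h : ∃ d, bad d
    · obtain ⟨d, hd⟩ := h
      exact ⟨d, hbadw d hd, fun d' hd' => hbad d' d hd' hd⟩
    · exact ⟨y.1, hy, fun d hd => absurd ⟨d, hd⟩ h⟩
  have hac : ∀ d : G.Dart, P.acrossCorner (d, 1) = (P.rot d, -1) := fun d => by
    simp [acrossCorner]
  have hpow : ∀ k : ℕ, ((P.rot ^ k) d₀).fst = w ∧ R (d₀, 1) ((P.rot ^ k) d₀, 1) := by
    intro k
    induction k with
    | zero => exact ⟨hd₀, hR.refl _⟩
    | succ k ih =>
      have h1 := P.acrossCorner_fst ((P.rot ^ k) d₀, 1)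
      have h2 := ha ((P.rot ^ k) d₀, 1) ih.1
      rw [hac, ← Equiv.Perm.mul_apply, ← pow_succ'] at h1 h2
      have h3 : ((P.rot ^ (k + 1)) d₀).fst = w := h1.trans ih.1
      refine ⟨h3, ?_⟩
      by_cases h : (P.rot ^ (k + 1)) d₀ = d₀
      · rw [h]
        exact hR.refl _
      · have h4 := hf ((P.rot ^ (k + 1)) d₀, -1) h3 fun hb' => h (hb _ hb')
        rw [flip, neg_neg] at h4
        exact hR.trans ih.2 (hR.trans h2 h4)
  have hone : ∀ d : G.Dart, d.fst = w → R (d₀, 1) (d, 1) := by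
    intro d hd
    obtain ⟨n, rfl⟩ := ((P.rot_isCycleOn w).2 hd₀ hd).exists_nat_pow_eq
    exact (hpow n).2
  have hall : ∀ x : DartSide G, x.1.fst = w → R (d₀, 1) x := by
    rintro ⟨d, s⟩ hd
    rcases Int.units_eq_one_or s with rfl | rfl
    · exact hone d hd
    · have h1 := P.acrossCorner_fst (d, -1)
      have h2 := P.acrossCorner_involutive (d, -1)
      have h3 := ha (P.acrossCorner (d, -1)) (h1.trans hd)
      rw [h2] at h3
      exact hR.trans (hone _ (h1.trans hd)) h3
  exact hR.trans (hR.symm (hall y hy)) (hall y' hy')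

variable {layer : V → ℕ} {par : V → V}

/-- Walking around the contour of a subtree. If the relations grow towards the root and relate the
sides that are joined by moving across a corner, along an edge, or across an edge outside
the forest, then all sides at a vertex are related. -/
theorem related_of_contour (hlayer : ∀ u, 0 < layer u → layer u = layer (par u) + 1)
    {R : V → DartSide G → DartSide G → Prop} (hR : ∀ w, Equivalence (R w))
    (hmono : ∀ c, 0 < layer c → ∀ y y', R c y y' → R (par c) y y')
    (ha : ∀ y, R y.1.fst y (P.acrossCorner y)) (he : ∀ y, R y.1.fst y (P.alongEdge y))
    (hf : ∀ y, y.1.edge ∉ treeEdges layer par → R y.1.fst y (flip y))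
    (w : V) (y y' : DartSide G) (hy : y.1.fst = w) (hy' : y'.1.fst = w) : R w y y' := by
  obtain ⟨M, hM⟩ : ∃ M, ∀ u, layer u ≤ M := by
    obtain ⟨M, hM⟩ := (Set.finite_range layer).bddAbove
    exact ⟨M, fun u => hM ⟨u, rfl⟩⟩
  induction hk : M - layer w using Nat.strong_induction_on generalizing w y y' with
  | _ k ih =>
    refine P.related_of_same_vertex (hR w)
      (bad := fun d => d.fst = w ∧ d.snd = par w) ?_ (fun d hd => hd.1) ?_ ?_ hy hy'
    · rintro d d' ⟨h1, h2⟩ ⟨h3, h4⟩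
      exact Dart.ext _ _ (Prod.ext (h1.trans h3.symm) (h2.trans h4.symm))
    · rintro y rfl
      exact ha y
    · rintro y rfl hbad
      by_cases hT : y.1.edge ∈ treeEdges layer par
      · obtain ⟨u, hu, hyu⟩ := hT
        have h1 := hlayer u hu
        have h2 := hM u
        change s(y.1.fst, y.1.snd) = s(u, par u) at hyu
        rw [Sym2.eq_iff] at hyu
        rcases hyu with ⟨h3, h4⟩ | ⟨h3, h4⟩
        · exact absurd ⟨rfl, by rw [h3]; exact h4⟩ hbad
        -- An edge to a child `u` is crossed by going along it, around the subtree of `u`, and back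
        -- on its other side. Only the edge to the parent is left uncrossed.
        · change y.1.fst = par u at h3
          have h5 := ih (M - layer u) (by rw [h3] at hk; omega) u (P.alongEdge y)
            (flip (P.alongEdge y)) h4 h4 rfl
          have h6 := hmono u hu _ _ h5
          rw [← h3] at h6
          have h7 := he (flip y)
          rw [alongEdge_flip] at h7
          exact (hR _).trans ((hR _).trans (he y) h6) ((hR _).symm h7)
      · exact hf y hT

end Contour

/-! ### The dual graph -/

/-- The face on a given side of a dart. -/
def face (x : DartSide G) : P.FacialWalk := Quot.mk _ x

theorem face_acrossCorner (x : DartSide G) : P.face (P.acrossCorner x) = P.face x :=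
  (Quot.sound (r := fun x y => y = P.acrossCorner x ∨ y = P.alongEdge x) (Or.inl rfl)).symm

theorem face_alongEdge (x : DartSide G) : P.face (P.alongEdge x) = P.face x :=
  (Quot.sound (r := fun x y => y = P.acrossCorner x ∨ y = P.alongEdge x) (Or.inr rfl)).symm

/-- The graph of the faces, two of them being adjacent if they share an edge that is not in `T`. -/
def dualGraph (T : Set (Sym2 V)) : SimpleGraph P.FacialWalk where
  Adj f f' := f ≠ f' ∧ ∃ y : DartSide G, P.face y = f ∧ P.face (flip y) = f' ∧ y.1.edge ∉ T
  symm := ⟨by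
    rintro f f' ⟨hne, y, h1, h2, h3⟩
    exact ⟨hne.symm, flip y, h2, by rw [flip_flip, h1], h3⟩⟩
  loopless := ⟨fun f h => h.1 rfl⟩

variable {layer : V → ℕ} {par : V → V} [Finite V]

theorem finite_facialWalk : Finite P.FacialWalk := by
  have := finite_dart (G := G)
  exact Quot.finite _

/-- Faces at the same component of the graph lie in the same component of the dual graph. -/
theorem dualGraph_reachable (hlayer : ∀ u, 0 < layer u → layer u = layer (par u) + 1)
    {y y' : DartSide G} (h : G.Reachable y.1.fst y'.1.fst) :
    (P.dualGraph (treeEdges layer par)).Reachable (P.face y) (P.face y') := by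
  have hloc := P.related_of_contour (layer := layer) (par := par) hlayer
    (R := fun _ y y' => (P.dualGraph (treeEdges layer par)).Reachable (P.face y) (P.face y'))
    (fun w => ⟨fun y => .rfl, fun h => h.symm, fun h h' => h.trans h'⟩) (fun c _ y y' h => h)
    (fun y => by rw [face_acrossCorner]) (fun y => by rw [face_alongEdge]) (by
      intro y hy
      by_cases h : P.face y = P.face (flip y)
      · rw [h]
      · exact Adj.reachable ⟨h, y, rfl, rfl, hy⟩)
  obtain ⟨p⟩ := h
  generalize hu : y.1.fst = u at p
  generalize hv : y'.1.fst = v at p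
  induction p generalizing y with
  | nil => exact hloc _ y y' hu hv
  | cons hadj q ih =>
    refine (hloc _ y (⟨(_, _), hadj⟩, 1) hu rfl).trans ?_
    rw [← face_alongEdge]
    exact ih rfl hv

/-- A breadth-first search in the dual graph: `x f` is the side through which the face `f`
is reached. -/
theorem exists_dual_bfs (hlayer : ∀ u, 0 < layer u → layer u = layer (par u) + 1) :
    ∃ (depth : P.FacialWalk → ℕ) (x : P.FacialWalk → DartSide G), (∀ f, P.face (x f) = f) ∧
      (∀ f, 0 < depth f → (x f).1.edge ∉ treeEdges layer par ∧
        depth f = depth (P.face (flip (x f))) + 1) ∧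
      Nat.card {f // depth f = 0} + Nat.card {v : V // ∀ w, ¬ G.Adj v w} ≤
        Nat.card G.ConnectedComponent := by
  have := P.finite_facialWalk
  obtain ⟨depth, up, hup, -, hcard⟩ := (P.dualGraph (treeEdges layer par)).exists_bfs
  have hx : ∀ f, ∃ x : DartSide G, P.face x = f ∧ (0 < depth f →
      x.1.edge ∉ treeEdges layer par ∧ depth f = depth (P.face (flip x)) + 1) := by
    intro f
    by_cases h : 0 < depth f
    · obtain ⟨⟨-, y, h1, h2, h3⟩, h4⟩ := hup f h
      exact ⟨y, h1, fun _ => ⟨h3, by rw [h2, h4]⟩⟩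
    · obtain ⟨y, hy⟩ := Quot.exists_rep f
      exact ⟨y, hy, fun h' => absurd h' h⟩
  choose x hxf hx using hx
  refine ⟨depth, x, hxf, hx, ?_⟩
  rw [hcard, ← Nat.card_sum]
  let D := P.dualGraph (treeEdges layer par)
  have hrep : ∀ c : D.ConnectedComponent, D.connectedComponentMk (P.face (x c.out)) = c :=
    fun c => by
      rw [hxf]
      exact Quot.out_eq c
  refine Nat.card_le_card_of_injective (Sum.elim
    (fun c : D.ConnectedComponent => G.connectedComponentMk (x c.out).1.fst)
    (fun v => G.connectedComponentMk v.1)) ?_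
  have hiso : ∀ v : {v : V // ∀ w, ¬ G.Adj v w}, ∀ u, G.Reachable v.1 u → v.1 = u := by
    rintro ⟨v, hv⟩ u ⟨p⟩
    cases p with
    | nil => rfl
    | cons h _ => exact absurd h (hv _)
  rintro (c | v) (c' | v') h
  · have := P.dualGraph_reachable hlayer (ConnectedComponent.exact h)
    rw [← hrep c, ← hrep c', ConnectedComponent.sound this]
  · have := hiso v' _ (ConnectedComponent.exact h).symm
    exact absurd (this ▸ (x c.out).1.adj) (v'.2 _)
  · have := hiso v _ (ConnectedComponent.exact h)
    exact absurd (this ▸ (x c'.out).1.adj) (v.2 _)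
  · rw [Subtype.ext (hiso v _ (ConnectedComponent.exact h))]

/-- The number of edges that belong neither to the forest nor to the dual forest is at most the
Euler genus. -/
theorem card_extraEdges_le (hpar : ∀ u, 0 < layer u → G.Adj u (par u) ∧ layer u = layer (par u) + 1)
    (hcard : Nat.card {u // layer u = 0} = Nat.card G.ConnectedComponent)
    {depth : P.FacialWalk → ℕ} {x : P.FacialWalk → DartSide G} (hxf : ∀ f, P.face (x f) = f)
    (hx : ∀ f, 0 < depth f → (x f).1.edge ∉ treeEdges layer par ∧
        depth f = depth (P.face (flip (x f))) + 1)
    (hle : Nat.card {f // depth f = 0} + Nat.card {v : V // ∀ w, ¬ G.Adj v w} ≤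
        Nat.card G.ConnectedComponent) :
    (Nat.card {e : G.edgeSet // e.1 ∉ treeEdges layer par ∧
      ∀ f, 0 < depth f → e.1 ≠ (x f).1.edge} : ℤ) ≤ P.eulerGenus := by
  have := P.finite_facialWalk
  have hV := card_pos_add_card_eq_zero layer
  have hF := card_pos_add_card_eq_zero depth
  have hE : Nat.card {u // 0 < layer u} + Nat.card {f // 0 < depth f} +
      Nat.card {e : G.edgeSet // e.1 ∉ treeEdges layer par ∧
        ∀ f, 0 < depth f → e.1 ≠ (x f).1.edge} ≤ Nat.card G.edgeSet := by
    rw [← Nat.card_sum, ← Nat.card_sum]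
    refine Nat.card_le_card_of_injective (Sum.elim (Sum.elim
      (fun u => (⟨s(u.1, par u.1), (hpar u.1 u.2).1⟩ : G.edgeSet))
      (fun f => ⟨(x f.1).1.edge, (x f.1).1.edge_mem⟩)) Subtype.val) ?_
    have hne : ∀ (u : {u // 0 < layer u}) (f : {f // 0 < depth f}),
        s(u.1, par u.1) ≠ (x f.1).1.edge := fun u f h => (hx f.1 f.2).1 ⟨u.1, u.2, h.symm⟩
    rintro ((u | f) | e) ((u' | f') | e') h
    · have h1 := (hpar u.1 u.2).2
      have h2 := (hpar u'.1 u'.2).2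
      rcases Sym2.eq_iff.1 (congrArg Subtype.val h) with ⟨h, -⟩ | ⟨h3, h4⟩
      · rw [Subtype.ext h]
      · rw [h4] at h1
        rw [← h3] at h2
        omega
    · exact absurd (congrArg Subtype.val h) (hne u f')
    · exact absurd ⟨u.1, u.2, (congrArg Subtype.val h).symm⟩ e'.2.1
    · exact absurd (congrArg Subtype.val h).symm (hne u' f)
    · have h1 := (hx f.1 f.2).2
      have h2 := (hx f'.1 f'.2).2
      have hf : f.1 = f'.1 ∨ f.1 = P.face (flip (x f'.1)) := by
        rcases P.eq_of_edge_eq (congrArg Subtype.val h) with h | h | h | h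
        · left; rw [← hxf f.1, h, hxf]
        · right; rw [← hxf f.1, h]
        · left; rw [← hxf f.1, h, face_alongEdge, hxf]
        · right; rw [← hxf f.1, h, ← alongEdge_flip, face_alongEdge]
      have hf' : f'.1 = f.1 ∨ f'.1 = P.face (flip (x f.1)) := by
        rcases P.eq_of_edge_eq (congrArg Subtype.val h).symm with h | h | h | h
        · left; rw [← hxf f'.1, h, hxf]
        · right; rw [← hxf f'.1, h]
        · left; rw [← hxf f'.1, h, face_alongEdge, hxf]
        · right; rw [← hxf f'.1, h, ← alongEdge_flip, face_alongEdge]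
      -- Two distinct faces entered through the same edge would be parents of each other, which
      -- their depths forbid.
      have heq : f.1 = f'.1 := by
        rcases hf with hf | hf
        · exact hf
        rcases hf' with hf' | hf'
        · exact hf'.symm
        rw [← hf'] at h1
        rw [← hf] at h2
        omega
      rw [Subtype.ext heq]
    · exact absurd (congrArg Subtype.val h).symm (e'.2.2 f.1 f.2)
    · exact absurd ⟨u'.1, u'.2, congrArg Subtype.val h⟩ e.2.1
    · exact absurd (congrArg Subtype.val h) (e.2.2 f'.1 f'.2)
    · rw [Subtype.ext h]
  -- Each forest has as many edges as it has vertices minus roots. The surplus is then bounded by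
  -- Euler's formula, with `hle` absorbing the dual roots and the isolated vertices.
  unfold eulerGenus numFaces
  omega

end SimpleGraph.EmbeddingScheme

namespace SimpleGraph.EmbeddingScheme

variable {V : Type*} {G : SimpleGraph V} (P : EmbeddingScheme G)

/-! ### The tree-decomposition of an embedded graph -/

/-- The boundary walk of a face, starting with the edge of `x`. -/
def facePath (x : DartSide G) : ℕ → DartSide G
  | 0 => x
  | i + 1 => if i % 2 = 0 then P.alongEdge (facePath x i) else P.acrossCorner (facePath x i)

theorem facePath_succ_of_even (x : DartSide G) {i : ℕ} (hi : i % 2 = 0) :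
    P.facePath x (i + 1) = P.alongEdge (P.facePath x i) := by
  rw [facePath, if_pos hi]

theorem facePath_succ_of_odd (x : DartSide G) {i : ℕ} (hi : i % 2 = 1) :
    P.facePath x (i + 1) = P.acrossCorner (P.facePath x i) := by
  rw [facePath, if_neg (by omega)]

theorem face_facePath (x : DartSide G) (i : ℕ) : P.face (P.facePath x i) = P.face x := by
  induction i with
  | zero => rfl
  | succ i ih =>
    rcases Nat.mod_two_eq_zero_or_one i with h | h
    · rw [P.facePath_succ_of_even x h, face_alongEdge, ih]
    · rw [P.facePath_succ_of_odd x h, face_acrossCorner, ih]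

/-- Two steps of the walk apply a product of two involutions, a permutation of finite order. The
walk closes up with a corner move at the start of `x`. -/
theorem exists_facePath_period [Finite V] (x : DartSide G) :
    ∃ K, 0 < K ∧ P.facePath x (2 * K) = x := by
  have := finite_dart (G := G)
  let φ : Equiv.Perm (DartSide G) :=
    P.acrossCorner_involutive.toPerm * P.alongEdge_involutive.toPerm
  have h : ∀ k : ℕ, P.facePath x (2 * k) = (φ ^ k) x := by
    intro k
    induction k with
    | zero => rfl
    | succ k ih =>
      rw [show 2 * (k + 1) = 2 * k + 1 + 1 by omega, P.facePath_succ_of_odd x (by omega),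
        P.facePath_succ_of_even x (by omega), ih, pow_succ']
      rfl
  exact ⟨orderOf φ, orderOf_pos φ, by rw [h, pow_orderOf_eq_one, Equiv.Perm.one_apply]⟩

theorem exists_facePath_alongEdge {x y : DartSide G} (h : ∃ i, P.facePath x i = y) :
    ∃ i, P.facePath x i = P.alongEdge y := by
  obtain ⟨i, rfl⟩ := h
  rcases Nat.mod_two_eq_zero_or_one i with h | h
  · exact ⟨i + 1, P.facePath_succ_of_even x h⟩
  · obtain ⟨j, rfl⟩ : ∃ j, i = j + 1 := ⟨i - 1, by omega⟩
    exact ⟨j, by rw [P.facePath_succ_of_even x (by omega), P.alongEdge_involutive]⟩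

theorem exists_facePath_acrossCorner [Finite V] {x y : DartSide G}
    (h : ∃ i, P.facePath x i = y) : ∃ i, P.facePath x i = P.acrossCorner y := by
  obtain ⟨i, rfl⟩ := h
  rcases Nat.mod_two_eq_zero_or_one i with h | h
  · obtain ⟨j, hj, hj'⟩ : ∃ j, j % 2 = 1 ∧ P.facePath x (j + 1) = P.facePath x i := by
      rcases Nat.eq_zero_or_pos i with rfl | hi
      · obtain ⟨K, hK, hK'⟩ := P.exists_facePath_period x
        exact ⟨2 * K - 1, by omega, by rw [show 2 * K - 1 + 1 = 2 * K by omega, hK']; rfl⟩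
      · exact ⟨i - 1, by omega, by rw [show i - 1 + 1 = i by omega]⟩
    exact ⟨j, by rw [← hj', P.facePath_succ_of_odd x hj, P.acrossCorner_involutive]⟩
  · exact ⟨i + 1, P.facePath_succ_of_odd x h⟩

theorem exists_facePath_eq [Finite V] {x y : DartSide G} (h : P.face y = P.face x) :
    ∃ i, P.facePath x i = y := by
  have key : ∀ a b, Relation.EqvGen
      (fun x y : DartSide G => y = P.acrossCorner x ∨ y = P.alongEdge x) a b →
      ((∃ i, P.facePath x i = a) ↔ ∃ i, P.facePath x i = b) := by
    intro a b hab
    induction hab with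
    | rel a b h =>
      rcases h with rfl | rfl
      · refine ⟨P.exists_facePath_acrossCorner, fun h => ?_⟩
        rw [← P.acrossCorner_involutive a]
        exact P.exists_facePath_acrossCorner h
      · refine ⟨P.exists_facePath_alongEdge, fun h => ?_⟩
        rw [← P.alongEdge_involutive a]
        exact P.exists_facePath_alongEdge h
    | refl => rfl
    | symm _ _ _ ih => exact ih.symm
    | trans _ _ _ _ _ ih₁ ih₂ => exact ih₁.trans ih₂
  exact (key y x (Quot.eqvGen_exact h)).2 ⟨0, rfl⟩

/-- The position of `y` on the boundary walk of its face that starts with the edge of `x`. -/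
noncomputable def faceIndex (x y : DartSide G) : ℕ := sInf {i | P.facePath x i = y}

theorem faceIndex_le {x y : DartSide G} {i : ℕ} (h : P.facePath x i = y) : P.faceIndex x y ≤ i :=
  Nat.sInf_le h

theorem faceIndex_self (x : DartSide G) : P.faceIndex x x = 0 :=
  Nat.le_zero.1 (P.faceIndex_le rfl)

/-- The parent of a side in the tree of the decomposition. The sides at a face form a path that
starts at `x f`, whose parent is across the edge of `x f`. -/
noncomputable def nodeParent (depth : P.FacialWalk → ℕ) (x : P.FacialWalk → DartSide G)
    (y : DartSide G) : Option (DartSide G) :=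
  if P.faceIndex (x (P.face y)) y = 0 then
    if 0 < depth (P.face y) then some (flip y) else none
  else some (P.facePath (x (P.face y)) (P.faceIndex (x (P.face y)) y - 1))

/-- The nodes whose bag contains `v`. The bag of a side consists of the ancestors of the two
ends of its edge and of the first vertex of its face. -/
def nodesOf (layer : V → ℕ) (par : V → V) (x : P.FacialWalk → DartSide G) (v : V) :
    Set (DartSide G) :=
  {y | IsAncestor layer par v y.1.fst ∨ IsAncestor layer par v y.1.snd ∨
    IsAncestor layer par v (x (P.face y)).1.fst}

variable {layer : V → ℕ} {par : V → V} {depth : P.FacialWalk → ℕ} {x : P.FacialWalk → DartSide G}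

theorem nodeParent_root (hxf : ∀ f, P.face (x f) = f) {f : P.FacialWalk} (hf : 0 < depth f) :
    P.nodeParent depth x (x f) = some (flip (x f)) := by
  rw [nodeParent, hxf, faceIndex_self, if_pos rfl, if_pos hf]

variable [Finite V]

theorem facePath_faceIndex {x y : DartSide G} (h : P.face y = P.face x) :
    P.facePath x (P.faceIndex x y) = y :=
  Nat.sInf_mem (P.exists_facePath_eq h)

theorem faceIndex_alongEdge {x y : DartSide G} (h : P.face y = P.face x) :
    P.faceIndex x (P.alongEdge y) = P.faceIndex x y + 1 ∨
    P.faceIndex x y = P.faceIndex x (P.alongEdge y) + 1 := by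
  have key : ∀ y, P.face y = P.face x → P.faceIndex x y % 2 = 0 →
      P.faceIndex x (P.alongEdge y) ≤ P.faceIndex x y + 1 := fun y h h0 =>
    P.faceIndex_le (by rw [P.facePath_succ_of_even x h0, P.facePath_faceIndex h])
  have key' : ∀ y, P.face y = P.face x → P.faceIndex x y % 2 = 1 →
      P.faceIndex x (P.alongEdge y) + 1 ≤ P.faceIndex x y := fun y h h0 => by
    have h1 : P.facePath x (P.faceIndex x y - 1) = P.alongEdge y := by
      rw [← P.alongEdge_involutive (P.facePath x (P.faceIndex x y - 1)),
        ← P.facePath_succ_of_even x (by omega), show P.faceIndex x y - 1 + 1 = P.faceIndex x y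
          by omega, P.facePath_faceIndex h]
    have := P.faceIndex_le h1
    omega
  have hne : P.faceIndex x (P.alongEdge y) ≠ P.faceIndex x y := by
    intro heq
    apply P.alongEdge_ne y
    rw [← P.facePath_faceIndex ((P.face_alongEdge y).trans h), heq, P.facePath_faceIndex h]
  have h1 := key y h
  have h1' := key' y h
  have h2 := key _ ((P.face_alongEdge y).trans h)
  have h2' := key' _ ((P.face_alongEdge y).trans h)
  rw [P.alongEdge_involutive] at h2 h2'
  omega

/-- The exceptions concern the closing corner, where the facial cycle is cut open to become a path.
It lies at the first vertex of the face, which is why that vertex belongs to every bag of the face.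
-/
theorem faceIndex_acrossCorner {x y : DartSide G} (h : P.face y = P.face x) :
    P.faceIndex x (P.acrossCorner y) = P.faceIndex x y + 1 ∨
    P.faceIndex x y = P.faceIndex x (P.acrossCorner y) + 1 ∨ y = x ∨ P.acrossCorner y = x := by
  have key : ∀ y, P.face y = P.face x → P.faceIndex x y % 2 = 1 →
      P.faceIndex x (P.acrossCorner y) ≤ P.faceIndex x y + 1 := fun y h h0 =>
    P.faceIndex_le (by rw [P.facePath_succ_of_odd x h0, P.facePath_faceIndex h])
  have key' : ∀ y, P.face y = P.face x → P.faceIndex x y % 2 = 0 → P.faceIndex x y ≠ 0 →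
      P.faceIndex x (P.acrossCorner y) + 1 ≤ P.faceIndex x y := fun y h h0 hpos => by
    have h1 : P.facePath x (P.faceIndex x y - 1) = P.acrossCorner y := by
      rw [← P.acrossCorner_involutive (P.facePath x (P.faceIndex x y - 1)),
        ← P.facePath_succ_of_odd x (by omega), show P.faceIndex x y - 1 + 1 = P.faceIndex x y
          by omega, P.facePath_faceIndex h]
    have := P.faceIndex_le h1
    omega
  have hzero : ∀ y, P.face y = P.face x → P.faceIndex x y = 0 → y = x := fun y h h0 => by
    rw [← P.facePath_faceIndex h, h0]
    rfl
  have hne : P.faceIndex x (P.acrossCorner y) ≠ P.faceIndex x y := by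
    intro heq
    apply P.acrossCorner_ne y
    rw [← P.facePath_faceIndex ((P.face_acrossCorner y).trans h), heq, P.facePath_faceIndex h]
  by_cases hy : P.faceIndex x y = 0
  · exact .inr (.inr (.inl (hzero y h hy)))
  by_cases hay : P.faceIndex x (P.acrossCorner y) = 0
  · exact .inr (.inr (.inr (hzero _ ((P.face_acrossCorner y).trans h) hay)))
  have h1 := key y h
  have h1' := key' y h
  have h2 := key _ ((P.face_acrossCorner y).trans h)
  have h2' := key' _ ((P.face_acrossCorner y).trans h)
  rw [P.acrossCorner_involutive] at h2 h2'
  omega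

theorem nodeParent_of_faceIndex (hxf : ∀ f, P.face (x f) = f) {y z : DartSide G}
    (hf : P.face z = P.face y)
    (h : P.faceIndex (x (P.face y)) y = P.faceIndex (x (P.face y)) z + 1) :
    P.nodeParent depth x y = some z := by
  rw [nodeParent, if_neg (by omega), h, Nat.add_sub_cancel,
    P.facePath_faceIndex (by rw [hxf, hf])]

theorem forestAdj_alongEdge (hxf : ∀ f, P.face (x f) = f) (y : DartSide G) :
    ForestAdj (P.nodeParent depth x) y (P.alongEdge y) := by
  have hf := P.face_alongEdge y
  rcases P.faceIndex_alongEdge (x := x (P.face y)) (y := y) (by rw [hxf]) with h | h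
  · exact .inr (P.nodeParent_of_faceIndex hxf hf.symm (by rw [hf, h]))
  · exact .inl (P.nodeParent_of_faceIndex hxf hf h)

theorem forestAdj_acrossCorner (hxf : ∀ f, P.face (x f) = f) (y : DartSide G) :
    ForestAdj (P.nodeParent depth x) y (P.acrossCorner y) ∨
    y = x (P.face y) ∨ P.acrossCorner y = x (P.face y) := by
  have hf := P.face_acrossCorner y
  rcases P.faceIndex_acrossCorner (x := x (P.face y)) (y := y) (by rw [hxf]) with h | h | h
  · exact .inl (.inr (P.nodeParent_of_faceIndex hxf hf.symm (by rw [hf, h])))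
  · exact .inl (.inl (P.nodeParent_of_faceIndex hxf hf h))
  · exact .inr h

/-- A parent is either earlier on the path of the same face or in a face of smaller depth, so the
lexicographic rank shows that the parent function is acyclic. -/
theorem rank_nodeParent_lt (hxf : ∀ f, P.face (x f) = f)
    (hx : ∀ f, 0 < depth f → depth f = depth (P.face (flip (x f))) + 1) (y p : DartSide G)
    (h : P.nodeParent depth x y = some p) :
    toLex (depth (P.face p), P.faceIndex (x (P.face p)) p) <
      toLex (depth (P.face y), P.faceIndex (x (P.face y)) y) := by
  rw [Prod.Lex.toLex_lt_toLex]
  unfold nodeParent at h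
  split_ifs at h with h0 h1
  · rw [Option.some_inj] at h
    have hy := P.facePath_faceIndex (x := x (P.face y)) (y := y) (by rw [hxf])
    rw [h0] at hy
    change x (P.face y) = y at hy
    have := hx _ h1
    rw [hy, h] at this
    left
    simp only
    omega
  · rw [Option.some_inj] at h
    have hf : P.face p = P.face y := by rw [← h, face_facePath, hxf]
    right
    have := P.faceIndex_le h
    rw [hf]
    simp only
    exact ⟨trivial, by omega⟩

/-- The nodes whose bag contains `v` are connected, if `v` is not an ancestor of an end of
an edge outside the forest and the dual forest. -/
theorem connOn_nodesOf
    (hpar : ∀ u, 0 < layer u → G.Adj u (par u) ∧ layer u = layer (par u) + 1)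
    (hxf : ∀ f, P.face (x f) = f) {U : Set V}
    (hU : ∀ y : DartSide G, y.1.fst ∉ U → y.1.edge ∉ treeEdges layer par →
      ∃ f, 0 < depth f ∧ y.1.edge = (x f).1.edge)
    {v : V} (hv : ∀ u ∈ U, ¬ IsAncestor layer par v u) :
    ConnOn (ForestAdj (P.nodeParent depth x)) (P.nodesOf layer par x v) := by
  let S := P.nodesOf layer par x
  let r : V → DartSide G → DartSide G → Prop := fun w a b =>
    ForestAdj (P.nodeParent depth x) a b ∧ a ∈ S w ∧ b ∈ S w
  let good : V → Prop := fun w => ∀ u ∈ U, ¬ IsAncestor layer par w u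
  -- Guarding by `good w` makes this meaningful at every vertex: descendants of good vertices are
  -- good, and bags are closed under ancestors, so the relation grows towards the root as the
  -- contour argument requires.
  let R : V → DartSide G → DartSide G → Prop := fun w a b =>
    good w → Relation.ReflTransGen (r w) a b
  have hsymm : ∀ w a b, Relation.ReflTransGen (r w) a b → Relation.ReflTransGen (r w) b a :=
    fun w a b h =>
      have : Std.Symm (r w) := ⟨fun a b h => ⟨h.1.symm, h.2.2, h.2.1⟩⟩
      Relation.ReflTransGen.stdSymm.symm a b h
  have hR : ∀ w, Equivalence (R w) := fun w =>
    ⟨fun a _ => .refl, fun h hw => hsymm w _ _ (h hw), fun h h' hw => (h hw).trans (h' hw)⟩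
  have hsub : ∀ {u w a}, IsAncestor layer par w u → a ∈ S u → a ∈ S w := by
    rintro u w a h (h1 | h1 | h1)
    · exact .inl (h.trans h1)
    · exact .inr (.inl (h.trans h1))
    · exact .inr (.inr (h.trans h1))
  have hgood : ∀ {u w}, IsAncestor layer par w u → good w → good u :=
    fun h hw z hz hz' => hw z hz (h.trans hz')
  have hmono : ∀ {u w}, IsAncestor layer par w u → ∀ a b, R u a b → R w a b := by
    intro u w h a b hab hw
    exact Relation.ReflTransGen.mono (fun a b hr => ⟨hr.1, hsub h hr.2.1, hsub h hr.2.2⟩) _ _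
      (hab (hgood h hw))
  have hface : ∀ w y, IsAncestor layer par w (x (P.face y)).1.fst → R w y (x (P.face y)) := by
    intro w y hw hgw
    induction hk : P.faceIndex (x (P.face y)) y using Nat.strong_induction_on generalizing y with
    | _ k ih =>
      have hy := P.facePath_faceIndex (x := x (P.face y)) (y := y) (by rw [hxf])
      rcases Nat.eq_zero_or_pos k with rfl | hpos
      · rw [hk] at hy
        change x (P.face y) = y at hy
        rw [hy]
      · set z := P.facePath (x (P.face y)) (k - 1) with hz
        have hfz : P.face z = P.face y := by rw [hz, face_facePath, hxf]
        have hlt := P.faceIndex_le hz.symm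
        have h1 := ih (P.faceIndex (x (P.face z)) z) (by rw [hfz]; omega) z (by rwa [hfz]) rfl
        rw [hfz] at h1
        refine .head ⟨.inl ?_, .inr (.inr hw), .inr (.inr (by rwa [hfz]))⟩ h1
        rw [nodeParent, if_neg (by omega), hk]
  have he : ∀ y, R y.1.fst y (P.alongEdge y) := fun y _ =>
    .single ⟨P.forestAdj_alongEdge hxf y, .inl (.refl _), .inr (.inl (.refl _))⟩
  have he' : ∀ y, R y.1.snd y (P.alongEdge y) := fun y _ =>
    .single ⟨P.forestAdj_alongEdge hxf y, .inr (.inl (.refl _)), .inl (.refl _)⟩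
  have hcontour := P.related_of_contour (fun u hu => (hpar u hu).2) hR
    (fun c hc => hmono (.parent hc)) (by
      intro y
      rcases P.forestAdj_acrossCorner hxf y with h | h
      · exact fun _ => .single ⟨h, .inl (.refl _),
          .inl (by rw [acrossCorner_fst]; exact .refl _)⟩
      · have hfst : (x (P.face y)).1.fst = y.1.fst := by
          rcases h with h | h
          · rw [← h]
          · rw [← h, acrossCorner_fst]
        have h1 := hface y.1.fst y (by rw [hfst]; exact .refl _)
        have h2 := hface y.1.fst (P.acrossCorner y)
          (by rw [face_acrossCorner, hfst]; exact .refl _)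
        rw [face_acrossCorner] at h2
        exact (hR _).trans h1 ((hR _).symm h2)) he (by
      intro y hy hgood
      -- A good vertex is no end of an extra edge, so an edge here outside the forest is a dual
      -- forest edge. It is crossed between `x f` and `flip (x f)`, after passing to its other end
      -- if necessary.
      obtain ⟨f, hf, hyf⟩ := hU y (fun h => hgood _ h (.refl _)) hy
      have hends : ∀ z : DartSide G, z.1.edge = y.1.edge → z ∈ S y.1.fst := by
        intro z hz
        have : y.1.fst ∈ z.1.edge := hz ▸ Sym2.mem_mk_left _ _
        rcases Sym2.mem_iff.1 this with h | h
        · exact .inl (h ▸ .refl _)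
        · exact .inr (.inl (h ▸ .refl _))
      have hstep : ∀ z : DartSide G, z.1.edge = y.1.edge →
          Relation.ReflTransGen (r y.1.fst) z (P.alongEdge z) := fun z hz =>
        .single ⟨P.forestAdj_alongEdge hxf z, hends z hz,
          hends _ ((P.alongEdge_edge z).trans hz)⟩
      have hcross : Relation.ReflTransGen (r y.1.fst) (x f) (flip (x f)) :=
        .single ⟨.inl (P.nodeParent_root hxf hf), hends _ hyf.symm, hends _ hyf.symm⟩
      have h1 := hstep (x f) hyf.symm
      have h2 := hstep (flip (x f)) hyf.symm
      rw [alongEdge_flip] at h2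
      rcases P.eq_of_edge_eq hyf with h | h | h | h
      · rw [h] at hcross ⊢
        exact hcross
      · rw [h] at hcross ⊢
        rw [flip_flip]
        exact hsymm _ _ _ hcross
      · have := (hsymm _ _ _ h1).trans (hcross.trans h2)
        rwa [← h] at this
      · have := (hsymm _ _ _ h2).trans ((hsymm _ _ _ hcross).trans h1)
        rwa [← h, show P.alongEdge (x f) = flip y by rw [h, flip_flip]] at this)
  -- A node that contains `v` because of a descendant `u` is joined, along the forest path from `u`,
  -- to a side that starts at `v`.
  have hdesc : ∀ u, IsAncestor layer par v u → ∀ y : DartSide G, y.1.fst = u →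
      ∃ z : DartSide G, z.1.fst = v ∧ R v y z := by
    intro u hu
    induction hu using Relation.ReflTransGen.head_induction_on with
    | refl => exact fun y hy => ⟨y, hy, (hR v).refl _⟩
    | @head c p hcp hpv ih =>
      intro y hy
      let d : DartSide G := (⟨(c, p), hcp.2 ▸ (hpar c hcp.1).1⟩, 1)
      obtain ⟨z, hz, hRz⟩ := ih (P.alongEdge d) rfl
      have h1 : R v y d := hmono (Relation.ReflTransGen.head hcp hpv) _ _
        (hcontour c y d hy rfl)
      have h2 : R v d (P.alongEdge d) := hmono hpv _ _ (he' d)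
      exact ⟨z, hz, (hR v).trans ((hR v).trans h1 h2) hRz⟩
  have hall : ∀ y ∈ S v, ∃ z : DartSide G, z.1.fst = v ∧ R v y z := by
    rintro y (h | h | h)
    · exact hdesc _ h y rfl
    · obtain ⟨z, hz, hRz⟩ := hdesc _ h (P.alongEdge y) rfl
      exact ⟨z, hz, (hR v).trans (hmono h _ _ (he' y)) hRz⟩
    · obtain ⟨z, hz, hRz⟩ := hdesc _ h (x (P.face y)) rfl
      exact ⟨z, hz, (hR v).trans (hface v y h) hRz⟩
  intro y hy y' hy'
  obtain ⟨z, hz, hRz⟩ := hall y hy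
  obtain ⟨z', hz', hRz'⟩ := hall y' hy'
  have := (hR v).trans ((hR v).trans hRz (hcontour v z z' hz hz')) ((hR v).symm hRz')
  exact Relation.ReflTransGen.mono (fun a b h => ⟨h.1, h.2.2⟩) _ _ (this hv)

end SimpleGraph.EmbeddingScheme

/-! ### Layered separators -/

/-- A few vertical paths of a breadth-first search forest can be removed from an embedded graph
such that what remains has balanced separators that consist of three vertical paths. -/
theorem SimpleGraph.EmbeddingScheme.exists_layered_separators {V : Type*} [Finite V]
    {G : SimpleGraph V} (P : EmbeddingScheme G) {g : ℕ} (hg : P.eulerGenus ≤ g) :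
    ∃ (layer : V → ℕ) (par : V → V) (m : ℕ) (ends : Fin m → V), m ≤ 2 * g ∧
      (∀ u, 0 < layer u → layer u = layer (par u) + 1) ∧
      (∀ u v, G.Adj u v → layer u ≤ layer v + 1) ∧
      ∀ B : Finset V, B.Nonempty → (∀ v ∈ B, ∀ i, ¬ IsAncestor layer par v (ends i)) →
        ∃ f : Fin 3 → V, ∀ C ⊆ B, ConnOn G.Adj (C : Set V) →
          (∀ v ∈ C, ∀ i, ¬ IsAncestor layer par v (f i)) → 2 * C.card ≤ B.card := by
  obtain ⟨layer, par, hpar, hadj, hcard⟩ := G.exists_bfs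
  have hlayer := fun u hu => (hpar u hu).2
  obtain ⟨depth, x, hxf, hx, hle⟩ := P.exists_dual_bfs hlayer
  have hX := P.card_extraEdges_le hpar hcard hxf hx hle
  set X := {e : G.edgeSet // e.1 ∉ treeEdges layer par ∧
    ∀ f, 0 < depth f → e.1 ≠ (x f).1.edge}
  have := finite_dart (G := G)
  let endOf : X × Bool → V := fun p => bif p.2 then (Quot.out p.1.1.1).1 else (Quot.out p.1.1.1).2
  refine ⟨layer, par, Nat.card (X × Bool), endOf ∘ (Finite.equivFin _).symm, ?_, hlayer, hadj, ?_⟩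
  · rw [Nat.card_prod, Nat.card_eq_fintype_card (α := Bool), Fintype.card_bool]
    omega
  intro B hB hBU
  have hBU' : ∀ v ∈ B, ∀ u ∈ Set.range endOf, ¬ IsAncestor layer par v u := by
    rintro v hv _ ⟨p, rfl⟩
    simpa using hBU v hv (Finite.equivFin _ p)
  by_cases hbig : ∃ C ⊆ B, ConnOn G.Adj (C : Set V) ∧ B.card < 2 * C.card
  · obtain ⟨C₀, hC₀B, hC₀, hC₀card⟩ := hbig
    have hc₀ := Finset.card_le_card hC₀B
    rcases Nat.lt_or_ge C₀.card 2 with h2 | h2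
    -- An isolated vertex lies on no side and may be missing from all bags, so a single vertex is
    -- separated by itself.
    · obtain ⟨b, rfl⟩ := Finset.card_eq_one.1 (show B.card = 1 by have := hB.card_pos; omega)
      refine ⟨fun _ => b, fun C hC _ hCb => ?_⟩
      rcases Finset.subset_singleton_iff.1 hC with rfl | rfl
      · simp
      · exact absurd (.refl _) (hCb b (Finset.mem_singleton_self b) 0)
    · obtain ⟨v, hv⟩ := Finset.card_pos.1 (by omega : 0 < C₀.card)
      obtain ⟨u, -, hvu⟩ := hC₀.exists_rel_of_two_le h2 hv
      have : Nonempty (DartSide G) := ⟨(⟨(v, u), hvu⟩, 1)⟩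
      obtain ⟨y, hy⟩ := exists_balanced_bag (r := G.Adj)
        (P.rank_nodeParent_lt hxf fun f hf => (hx f hf).2) (B := B)
        (S := P.nodesOf layer par x) (fun v hv => P.connOn_nodesOf hpar hxf (by
          intro y hyU hyT
          by_contra! hcon
          refine hyU ?_
          let e : X := ⟨⟨y.1.edge, y.1.edge_mem⟩, hyT, hcon⟩
          have hmem : y.1.fst ∈ s((Quot.out y.1.edge).1, (Quot.out y.1.edge).2) := by
            rw [show s((Quot.out y.1.edge).1, (Quot.out y.1.edge).2) = y.1.edge from
              Quot.out_eq y.1.edge]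
            exact Sym2.mem_mk_left _ _
          rcases Sym2.mem_iff.1 hmem with h | h
          · exact ⟨(e, true), h.symm⟩
          · exact ⟨(e, false), h.symm⟩) (hBU' v hv))
        (fun u _ v _ huv => ⟨(⟨(u, v), huv⟩, 1), .inl (.refl _), .inr (.inl (.refl _))⟩)
      refine ⟨![y.1.fst, y.1.snd, (x (P.face y)).1.fst], fun C hCB hC hCy => ?_⟩
      rcases Nat.lt_or_ge C.card 2 with h3 | h3
      · omega
      · refine hy C hCB hC h3 fun v hv hyv => ?_
        rcases hyv with h | h | h
        · exact hCy v hv 0 h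
        · exact hCy v hv 1 h
        · exact hCy v hv 2 h
  · push Not at hbig
    obtain ⟨b, -⟩ := hB
    exact ⟨fun _ => b, fun C hCB hC _ => hbig C hCB hC⟩

/-! ### Colouring with the help of separators -/

/-- For a symmetric relation it is enough to reach all points from one. -/
theorem connOn_of_reachable {N : Type*} {r : N → N → Prop} (hr : ∀ a b, r a b → r b a) {S : Set N}
    {x : N} (hx : x ∈ S)
    (h : ∀ y ∈ S, Relation.ReflTransGen (fun a b => r a b ∧ b ∈ S) x y) : ConnOn r S := by
  have key : ∀ y, Relation.ReflTransGen (fun a b => r a b ∧ b ∈ S) x y → y ∈ S ∧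
      Relation.ReflTransGen (fun a b => r a b ∧ b ∈ S) y x := by
    intro y hy
    induction hy with
    | refl => exact ⟨hx, .refl⟩
    | tail _ hbc ih => exact ⟨hbc.2, .head ⟨hr _ _ hbc.1, ih.1⟩ ih.2⟩
  exact fun y hy z hz => (key y (h y hy)).2.trans (h z hz)

theorem SimpleGraph.Walk.connOn_support {V : Type*} {G : SimpleGraph V} {u v : V}
    (p : G.Walk u v) : ConnOn G.Adj {x | x ∈ p.support} := by
  refine connOn_of_reachable (fun a b h => h.symm) p.start_mem_support fun y hy => ?_
  obtain ⟨n, rfl, hn⟩ := Walk.mem_support_iff_exists_getVert.1 hy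
  clear hy
  induction n with
  | zero => rw [Walk.getVert_zero]
  | succ n ih =>
    exact (ih (by omega)).tail ⟨p.adj_getVert_succ (by omega), p.getVert_mem_support _⟩

/-- Recursive separators give rise to a labelling with few depths in which each connected set has a
depth at which its vertices in the same layer have distinct labels. -/
theorem exists_depth_labelling {V : Type*} {G : SimpleGraph V} {layer : V → ℕ}
    {par : V → V} (hlayer : ∀ u, 0 < layer u → layer u = layer (par u) + 1) {ℓ : ℕ} [NeZero ℓ]
    {W : Set V}
    (hsep : ∀ B : Finset V, B.Nonempty → (B : Set V) ⊆ W →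
        ∃ f : Fin ℓ → V, ∀ C ⊆ B, ConnOn G.Adj (C : Set V) →
          (∀ v ∈ C, ∀ i, ¬ IsAncestor layer par v (f i)) → 2 * C.card ≤ B.card)
    (k : ℕ) (B : Finset V) (hBW : (B : Set V) ⊆ W) (hB : B.card < 2 ^ k) :
    ∃ c : V → ℕ × Fin ℓ, (∀ v ∈ B, (c v).1 < k) ∧
      ∀ C ⊆ B, C.Nonempty → ConnOn G.Adj (C : Set V) → ∃ v ∈ C, ∀ v' ∈ C, ∀ w ∈ C,
        (c v').1 = (c v).1 → c w = c v' → layer w = layer v' → w = v' := by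
  classical
  induction k generalizing B with
  | zero =>
    obtain rfl : B = ∅ := by simpa using hB
    refine ⟨fun _ => (0, 0), by simp, fun C hC hne => ?_⟩
    exact absurd (Finset.subset_empty.1 hC) hne.ne_empty
  | succ k ih =>
    rcases B.eq_empty_or_nonempty with rfl | hBne
    · refine ⟨fun _ => (0, 0), by simp, fun C hC hne => ?_⟩
      exact absurd (Finset.subset_empty.1 hC) hne.ne_empty
    obtain ⟨f, hf⟩ := hsep B hBne hBW
    let B' := B.filter fun v => ∀ i, ¬ IsAncestor layer par v (f i)
    let r : V → V → Prop := fun a b => (G.Adj a b ∧ a ∈ B') ∧ b ∈ B'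
    have hrs : Std.Symm (Relation.ReflTransGen r) :=
      have : Std.Symm r := ⟨fun a b h => ⟨⟨h.1.1.symm, h.2⟩, h.1.2⟩⟩
      Relation.ReflTransGen.stdSymm
    -- The component of `v` after the separator has been removed; it has fewer than `2 ^ k`
    -- vertices.
    let K : V → Finset V := fun v => B'.filter fun w => Relation.ReflTransGen r v w
    have hK : ∀ v ∈ B', ConnOn G.Adj (K v : Set V) := by
      intro v hv
      refine connOn_of_reachable (fun a b h => h.symm) (x := v)
        (Finset.mem_coe.2 (Finset.mem_filter.2 ⟨hv, .refl⟩)) fun y hy => ?_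
      have hvy := (Finset.mem_filter.1 (Finset.mem_coe.1 hy)).2
      clear hy
      induction hvy with
      | refl => exact .refl
      | tail hab hbc ih =>
        exact ih.tail ⟨hbc.1.1, Finset.mem_coe.2 (Finset.mem_filter.2 ⟨hbc.2, hab.tail hbc⟩)⟩
    have hKB : ∀ v, K v ⊆ B := fun v =>
      (Finset.filter_subset _ _).trans (Finset.filter_subset _ _)
    have hKcard : ∀ v ∈ B', (K v).card < 2 ^ k := by
      intro v hv
      have := hf (K v) (hKB v) (hK v hv)
        fun w hw => (Finset.mem_filter.1 (Finset.mem_filter.1 hw).1).2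
      rw [pow_succ] at hB
      omega
    -- One labelling is chosen per vertex set rather than per vertex, so vertices of the same
    -- component share it. The default `(0, 0)` is never used.
    have hc : ∀ D : Finset V, ∃ c : V → ℕ × Fin ℓ, D ⊆ B → D.card < 2 ^ k →
        (∀ w ∈ D, (c w).1 < k) ∧
        ∀ C ⊆ D, C.Nonempty → ConnOn G.Adj (C : Set V) → ∃ v ∈ C, ∀ v' ∈ C, ∀ w ∈ C,
          (c v').1 = (c v).1 → c w = c v' → layer w = layer v' → w = v' := by
      intro D
      by_cases hD : D ⊆ B ∧ D.card < 2 ^ k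
      · obtain ⟨c, hc⟩ := ih D (fun w hw => hBW (hD.1 hw)) hD.2
        exact ⟨c, fun _ _ => hc⟩
      · exact ⟨fun _ => (0, 0), fun h h' => absurd ⟨h, h'⟩ hD⟩
    choose c hc using hc
    let col : V → ℕ × Fin ℓ := fun v =>
      if h : ∃ i, IsAncestor layer par v (f i) then (0, h.choose)
      else ((c (K v) v).1 + 1, (c (K v) v).2)
    have hcolS : ∀ v (h : ∃ i, IsAncestor layer par v (f i)), col v = (0, h.choose) :=
      fun v h => dif_pos h
    have hcolB : ∀ v ∈ B', col v = ((c (K v) v).1 + 1, (c (K v) v).2) :=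
      fun v hv => dif_neg (not_exists.2 (Finset.mem_filter.1 hv).2)
    have hself : ∀ v ∈ B', v ∈ K v := fun v hv => Finset.mem_filter.2 ⟨hv, .refl⟩
    have hB'iff : ∀ v ∈ B, v ∉ B' → ∃ i, IsAncestor layer par v (f i) := by
      intro v hv hv'
      by_contra hcon
      exact hv' (Finset.mem_filter.2 ⟨hv, not_exists.1 hcon⟩)
    refine ⟨col, ?_, ?_⟩
    · intro v hv
      by_cases hv' : v ∈ B'
      · rw [hcolB v hv']
        have := (hc (K v) (hKB v) (hKcard v hv')).1 v (hself v hv')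
        simp only
        omega
      · rw [hcolS v (hB'iff v hv hv')]
        simp
    intro C hCB hCne hC
    -- If `C` meets the separator, depth 0 serves, since its labels name vertical paths. Otherwise
    -- `C` lies in one component and the induction hypothesis applies, all depths being raised by
    -- one.
    by_cases hCS : ∃ v ∈ C, ∃ i, IsAncestor layer par v (f i)
    · obtain ⟨v, hv, hvS⟩ := hCS
      refine ⟨v, hv, fun v' hv' w hw h1 h2 h3 => ?_⟩
      have hS : ∀ z ∈ C, (col z).1 = 0 → ∃ i, IsAncestor layer par z (f i) := by
        intro z hz h0
        refine hB'iff z (hCB hz) fun hz' => ?_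
        rw [hcolB z hz'] at h0
        simp at h0
      have h0 : (col v').1 = 0 := by rw [h1, hcolS v hvS]
      have hv'S := hS v' hv' h0
      have hwS := hS w hw (by rw [h2, h0])
      rw [hcolS v' hv'S, hcolS w hwS, Prod.mk.injEq] at h2
      have hw' := hwS.choose_spec
      rw [h2.2] at hw'
      exact hw'.eq_of_layer_eq hlayer hv'S.choose_spec h3
    · have hCB' : ∀ v ∈ C, v ∈ B' := fun v hv => Finset.mem_filter.2
        ⟨hCB hv, fun i hi => hCS ⟨v, hv, i, hi⟩⟩
      obtain ⟨v₀, hv₀⟩ := hCne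
      have hreach : ∀ v ∈ C, Relation.ReflTransGen r v₀ v := by
        have key : ∀ v, Relation.ReflTransGen (fun a b => G.Adj a b ∧ b ∈ (C : Set V)) v₀ v →
            v ∈ C ∧ Relation.ReflTransGen r v₀ v := by
          intro v hv
          induction hv with
          | refl => exact ⟨hv₀, .refl⟩
          | tail _ hbc ih =>
            exact ⟨hbc.2, ih.2.tail ⟨⟨hbc.1, hCB' _ ih.1⟩, hCB' _ hbc.2⟩⟩
        exact fun v hv => (key v (hC v₀ hv₀ v hv)).2
      have hKeq : ∀ v ∈ C, K v = K v₀ := by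
        intro v hv
        refine Finset.filter_congr fun w _ => ⟨fun h => (hreach v hv).trans h, fun h => ?_⟩
        exact (hrs.symm _ _ (hreach v hv)).trans h
      have hCK : C ⊆ K v₀ := fun v hv => Finset.mem_filter.2 ⟨hCB' v hv, hreach v hv⟩
      obtain ⟨v, hv, hvC⟩ := (hc (K v₀) (hKB v₀) (hKcard v₀ (hCB' v₀ hv₀))).2 C hCK
        ⟨v₀, hv₀⟩ hC
      refine ⟨v, hv, fun v' hv' w hw h1 h2 h3 => ?_⟩
      rw [hcolB v' (hCB' v' hv'), hKeq v' hv'] at h1 h2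
      rw [hcolB v (hCB' v hv), hKeq v hv] at h1
      rw [hcolB w (hCB' w hw), hKeq w hw, Prod.mk.injEq] at h2
      exact hvC v' hv' w hw (by simpa using h1) (Prod.ext (by simpa using h2.1) h2.2) h3

/-- Layered separators that consist of `ℓ` vertical paths, after the removal of `m` vertical paths,
give rise to a nonrepetitive colouring. -/
theorem SimpleGraph.exists_isNonrepetitive_of_separators {V : Type*} [Finite V]
    {G : SimpleGraph V} {layer : V → ℕ} {par : V → V}
    (hlayer : ∀ u, 0 < layer u → layer u = layer (par u) + 1)
    (hadj : ∀ u v, G.Adj u v → layer u ≤ layer v + 1) {m ℓ k : ℕ} [NeZero ℓ] {ends : Fin m → V}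
    (hsep : ∀ B : Finset V, B.Nonempty → (∀ v ∈ B, ∀ i, ¬ IsAncestor layer par v (ends i)) →
        ∃ f : Fin ℓ → V, ∀ C ⊆ B, ConnOn G.Adj (C : Set V) →
          (∀ v ∈ C, ∀ i, ¬ IsAncestor layer par v (f i)) → 2 * C.card ≤ B.card)
    (hk : Nat.card V < 2 ^ k) :
    ∃ ψ : V → Fin 4 × (Fin m ⊕ Fin k × Fin ℓ), G.IsNonrepetitive ψ := by
  classical
  have := Fintype.ofFinite V
  obtain ⟨word, hword, hsq⟩ := exists_squareFree_word
  let W : Set V := {v | ∀ i, ¬ IsAncestor layer par v (ends i)}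
  let B : Finset V := Finset.univ.filter (· ∈ W)
  have hBW : ∀ v, v ∈ B ↔ v ∈ W := fun v => by simp [B]
  obtain ⟨c, hck, hc⟩ := exists_depth_labelling (G := G) hlayer (W := W)
    (fun B hB hBW => hsep B hB fun v hv => hBW hv) k B (fun v hv => (hBW v).1 hv)
    ((Finset.card_le_univ B).trans_lt (by rwa [← Nat.card_eq_fintype_card]))
  let lab : V → Fin m ⊕ Fin k × Fin ℓ := fun v =>
    if h : ∃ i, IsAncestor layer par v (ends i) then .inl h.choose
    else .inr (⟨(c v).1, hck v ((hBW v).2 (not_exists.1 h))⟩, (c v).2)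
  have hlabS : ∀ v (h : ∃ i, IsAncestor layer par v (ends i)), lab v = .inl h.choose :=
    fun v h => dif_pos h
  have hlabW : ∀ v (h : v ∈ W), lab v = .inr (⟨(c v).1, hck v ((hBW v).2 h)⟩, (c v).2) :=
    fun v h => dif_neg (not_exists.2 h)
  refine ⟨fun v => (word (layer v), lab v), ?_⟩
  rintro u v p hp ⟨t, ht, hlen, hrep⟩
  have hlay : ∀ i < t, layer (p.getVert i) = layer (p.getVert (t + i)) := by
    refine lazy_walk_boring hword hsq (l := fun i => layer (p.getVert i)) ?_
      fun i hi => congrArg Prod.fst (hrep i hi)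
    intro i hi
    have h := p.adj_getVert_succ (show i < p.length by omega)
    exact ⟨hadj _ _ h.symm, hadj _ _ h⟩
  have hlab : ∀ i < t, lab (p.getVert i) = lab (p.getVert (t + i)) :=
    fun i hi => congrArg Prod.snd (hrep i hi)
  -- If the path avoids the removed vertical paths, its support is a connected set of separated
  -- vertices; otherwise take a vertex on a removed path. The counterpart of `z` in the other half
  -- has its label and layer, hence equals `z`, although the vertices of a path are distinct.
  obtain ⟨z, hz, huniq⟩ : ∃ z ∈ p.support, ∀ w ∈ p.support, lab w = lab z →
      layer w = layer z → w = z := by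
    by_cases hW : ∀ z ∈ p.support, z ∈ W
    · obtain ⟨z, hz, h⟩ := hc p.support.toFinset
        (fun z hz => (hBW z).2 (hW z (List.mem_toFinset.1 hz)))
        ⟨u, List.mem_toFinset.2 p.start_mem_support⟩
        (by simpa [ConnOn] using p.connOn_support)
      have hz' := List.mem_toFinset.1 hz
      refine ⟨z, hz', fun w hw hl => ?_⟩
      rw [hlabW w (hW w hw), hlabW z (hW z hz'), Sum.inr.injEq, Prod.mk.injEq,
        Fin.mk.injEq] at hl
      exact h z hz w (List.mem_toFinset.2 hw) rfl (Prod.ext hl.1 hl.2)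
    · push Not at hW
      obtain ⟨z, hz, hzW⟩ := hW
      have hzS : ∃ i, IsAncestor layer par z (ends i) := by
        by_contra hcon
        exact hzW (not_exists.1 hcon)
      refine ⟨z, hz, fun w hw hl => ?_⟩
      have hwS : ∃ i, IsAncestor layer par w (ends i) := by
        by_contra hcon
        rw [hlabW w (not_exists.1 hcon), hlabS z hzS] at hl
        cases hl
      rw [hlabS w hwS, hlabS z hzS, Sum.inl.injEq] at hl
      have hw' := hwS.choose_spec
      rw [hl] at hw'
      exact hw'.eq_of_layer_eq hlayer hzS.choose_spec
  obtain ⟨j, rfl, hj⟩ := Walk.mem_support_iff_exists_getVert.1 hz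
  have hinj : ∀ i, i < t → p.getVert i ≠ p.getVert (t + i) := by
    intro i hi h
    have := hp.getVert_injOn (show i ∈ {i | i ≤ p.length} by
      simp only [Set.mem_ofPred_eq]; omega) (show t + i ∈ {i | i ≤ p.length} by
      simp only [Set.mem_ofPred_eq]; omega) h
    omega
  rcases Nat.lt_or_ge j t with h | h
  · exact hinj j h (huniq _ (p.getVert_mem_support _) (hlab j h).symm (hlay j h).symm).symm
  · obtain ⟨i, rfl⟩ := Nat.exists_eq_add_of_le h
    exact hinj i (by omega) (huniq _ (p.getVert_mem_support _) (hlab i (by omega))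
      (hlay i (by omega)))

/-! ### Counting the colours -/

theorem SimpleGraph.nonrepetitiveChromaticNumber_le {V : Type*} {G : SimpleGraph V} {C : Type*}
    [Finite C] {ψ : V → C} (hψ : G.IsNonrepetitive ψ) :
    G.nonrepetitiveChromaticNumber ≤ Nat.card C := by
  refine Nat.sInf_le ⟨Finite.equivFin C ∘ ψ, ?_⟩
  rintro u v p hp ⟨t, ht, hlen, h⟩
  exact hψ u v p hp ⟨t, ht, hlen, fun i hi => (Finite.equivFin C).injective (h i hi)⟩

theorem mainTheorem8 {V : Type*} [Fintype V] [Nonempty V] (G : SimpleGraph V) (n g : ℕ)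
    (hn : Fintype.card V = n) (hg : G.eulerGenus = g) :
    (G.nonrepetitiveChromaticNumber : ℝ) ≤
      8 * (g : ℝ) + 12 * (1 + Real.logb (3 / 2) (n : ℝ)) := by
  obtain ⟨P, hP⟩ : G.EmbedsInEulerGenus g := hg ▸ Nat.sInf_mem G.exists_embedsInEulerGenus
  obtain ⟨layer, par, m, ends, hm, hlayer, hadj, hsep⟩ := P.exists_layered_separators hP
  obtain ⟨ψ, hψ⟩ := SimpleGraph.exists_isNonrepetitive_of_separators hlayer hadj hsep
    -- The number of times `n` vertices can be halved before none is left.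
    (k := Nat.log 2 n + 1) (by
      rw [Nat.card_eq_fintype_card, hn]
      exact Nat.lt_pow_succ_log_self one_lt_two n)
  have hle := SimpleGraph.nonrepetitiveChromaticNumber_le hψ
  simp only [Nat.card_prod, Nat.card_sum, Nat.card_fin] at hle
  have hn1 : (1 : ℝ) ≤ n := by
    rw [← hn]
    exact_mod_cast Fintype.card_pos (α := V)
  have hlog : (Nat.log 2 n : ℝ) ≤ Real.logb (3 / 2) n := by
    refine (Real.natLog_le_logb n 2).trans ?_
    rw [Real.logb, Real.logb, Nat.cast_ofNat]
    exact div_le_div_of_nonneg_left (Real.log_nonneg hn1) (Real.log_pos (by norm_num))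
      (Real.log_le_log (by norm_num) (by norm_num))
  have hle' : (G.nonrepetitiveChromaticNumber : ℝ) ≤ 4 * (m + (Nat.log 2 n + 1) * 3) := by
    exact_mod_cast hle
  have hm' : (m : ℝ) ≤ 2 * g := by exact_mod_cast hm
  linarith
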